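/- Let $n_p,n_y,n_c,\hat n_c\ge 0$ be integers with $\hat n_c\ge n_c$. \textbf{Signals.} Let $e(t)\in\mathbb R^{n_y}$, $t\in\mathbb Z$, be i.i.d. Gaussian, $e(t)\sim\mathcal N(0,\Sigma_e)$ with $\Sigma_e$ nonsingular. Let $p_1,\dots,p_{n_p}$ be real scheduling processes indexed by $\mathbb Z$ satisfying condition A2: each $p_i$ is a zero-mean white noise (independent and identically distributed in time) with positive finite variance, the processes $p_i$ are mutually independent, $(p_1,\dots,p_{n_p})$ is independent of $e$, and $\mathbb E|p_i^k(t)p_j^l(t)|<\infty$ for all $i,j$ and all $2\le k+l\le 6+\hat n_c$. Put $p_0\equiv 1$, and for a string $\eta=(\eta_0,\dots,\eta_m)\in\{0,\dots,n_p\}^{m+1}$ put $p_\eta(t)=\prod_{i=0}^{m}p_{\eta_i}(t-i)$. \textbf{Filters.} A noise filter of order $n$ is given by real $n_y\times n_y$ matrices (sub-Markov parameters) $\mathtt h_\eta$ for all strings $\eta$ over $\{0,\dots,n_p\}$ of length $2,\dots,n+1$. Its coefficients are $\mathcal C_0=I$ and $\mathcal C_j(p,t)=\sum_{|\eta|=j+1}\mathtt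 h_\eta\,p_\eta(t)$ for $1\le j\le n$, with $\mathcal C_j=0$ for $j>n$. Its inverse filter $\Gamma=\sum_{i\ge0}\Gamma_iq^{-i}$ is given by $\Gamma_0=I$ and $\Gamma_i(p,t)=-\sum_{l=0}^{i-1}\Gamma_l(p,t)\,\mathcal C_{i-l}(p,t-l)$ for $i\ge1$. The filter is called stably invertible (in mean square) if $\sum_{i\ge0}\mathbb E\|\Gamma_i(p,t)\|_F^2<\infty$ for all $t$. Let $\Theta_n$ be the set of parameter vectors $\theta$ (all scalar entries of all $\mathtt h_\eta$) of stably invertible filters of order $n$. \textbf{System, model and loss.} The data are generated by the pure moving-average system $y(t)=\sum_{j=0}^{n_c}\mathcal C_j(p,t)e(t-j)$ with true parameters $\mathtt h_\eta$, $2\le|\eta|\le n_c+1$, forming a stably invertible filter. For a model filter $\hat{\mathcal C}(\theta)$ of order $\hat n_c$ with $\theta\in\Theta_{\hat n_c}$ and sub-Markov parameters $\hat{\mathtt h}_\eta$, let $\hat\Gamma_i(\theta,p,t)$ be the coefficients of its inverse filter, and set $$\varepsilon(\theta,t)=\sum_{i\ge0}\hat\Gamma_i(\theta,p,t)\,y(t-i),\qquad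 V_{\infty,2}(\theta)=\lim_{N\to\infty}\frac1N\sum_{t=1}^N\mathrm{Tr}\,\mathbb E\{\varepsilon(\theta,t)\varepsilon(\theta,t)^\top\}.$$ \textbf{Claim.} $\Theta_{\hat n_c}$ is open. For each $\theta\in\Theta_{\hat n_c}$ and each $t$ the series $\varepsilon(\theta,t)$ converges (unconditionally) almost surely and is square integrable; the limit $V_{\infty,2}(\theta)$ exists, and $V_{\infty,2}$ is differentiable on $\Theta_{\hat n_c}$. Let $\theta_0$ be the parameter vector with $\hat{\mathtt h}_\eta=\mathtt h_\eta$ for $2\le|\eta|\le n_c+1$ and $\hat{\mathtt h}_\eta=0$ for $n_c+2\le|\eta|\le\hat n_c+1$. Then $\theta_0\in\Theta_{\hat n_c}$, $$\min_{\theta\in\Theta_{\hat n_c}}V_{\infty,2}(\theta)=\mathrm{Tr}(\Sigma_e),$$ the minimum is attained exactly at $\theta_0$, and $\theta_0$ is the unique stationary point of $V_{\infty,2}$: for $\theta\in\Theta_{\hat n_c}$, all partial derivatives of $V_{\infty,2}$ vanish at $\theta$ if and only if $\theta=\theta_0$. -/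

import Mathlib

open MeasureTheory ProbabilityTheory Filter Topology

noncomputable section

namespace LPVMA

/-- Index set of the scalar noise parameters of a moving-average filter of order `n`, with
`np` scheduling signals and `ny` outputs. An element `((k, η), a, b)` stands for the entry `(a, b)`
of the sub-Markov parameter `h_η`, where `η` is a string of `k + 2` characters in `{0, …, np}`;
`k < n`, so the strings have length `2, …, n + 1`. -/
abbrev ParamIdx (np ny n : ℕ) : Type :=
  ((k : Fin n) × (Fin (k.val + 2) → Fin (np + 1))) × Fin ny × Fin ny

/-- The parameter vector: all entries of all sub-Markov parameters of a filter of order `n`. -/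
abbrev Param (np ny n : ℕ) : Type := ParamIdx np ny n → ℝ

/-- The parameter vector of order `n` as one of order `m`: parameters of strings that are
too long for order `n` are zero. -/
def extend {np ny n : ℕ} (m : ℕ) (θ : Param np ny n) : Param np ny m := fun x =>
  if hk : x.1.1.val < n then θ (⟨⟨x.1.1.val, hk⟩, x.1.2⟩, x.2) else 0

/-- Scheduling signals at time `t` with the convention `p_0 = 1`. -/
def sched {np : ℕ} (p : Fin np → ℤ → ℝ) (a : Fin (np + 1)) (t : ℤ) : ℝ :=
  Fin.cases (motive := fun _ => ℝ) 1 (fun i => p i t) a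

/-- `p_η(t) = ∏ᵢ p_{ηᵢ}(t - i)`, where the characters of `η` are numbered from `0`. -/
def schedProd {np m : ℕ} (p : Fin np → ℤ → ℝ) (η : Fin m → Fin (np + 1)) (t : ℤ) : ℝ :=
  ∏ i : Fin m, sched p (η i) (t - (i.val : ℤ))

/-- The matrix coefficients of the monic filter of order `n` with parameter vector `θ` along the
scheduling trajectory `p` at time `t`: `C_0 = I`, `C_j(p, t) = ∑_{|η| = j + 1} h_η p_η(t)` for
`1 ≤ j ≤ n`, and `C_j = 0` for `j > n`. -/
def coeff {np ny n : ℕ} (θ : Param np ny n) (p : Fin np → ℤ → ℝ) (t : ℤ) :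
    ℕ → Matrix (Fin ny) (Fin ny) ℝ
  | 0 => 1
  | j + 1 =>
    if hj : j < n then
      ∑ η : Fin (j + 2) → Fin (np + 1),
        schedProd p η t • Matrix.of fun a b => θ (⟨⟨j, hj⟩, η⟩, a, b)
    else 0

/-- The coefficients `Γ_i(θ, p, t)` of the inverse filter `Γ = ∑ Γ_i q^{-i}` of the filter with
coefficients `coeff θ p t`. -/
def invCoeff {np ny n : ℕ} (θ : Param np ny n) (p : Fin np → ℤ → ℝ) (t : ℤ) :
    ℕ → Matrix (Fin ny) (Fin ny) ℝ
  | 0 => 1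
  | i + 1 => -∑ l : Fin (i + 1),
      invCoeff θ p t l.val * coeff θ p (t - (l.val : ℤ)) (i + 1 - l.val)
  termination_by i => i
  decreasing_by exact l.isLt

/-- `Γ C = I`, the coefficients of the noncommutative product being
`∑_{l ≤ i} Γ_l(t) C_{i - l}(t - l)`. -/
theorem invCoeff_mul_coeff {np ny n : ℕ} (θ : Param np ny n) (p : Fin np → ℤ → ℝ) (t : ℤ)
    (i : ℕ) :
    ∑ l ∈ Finset.range (i + 1), invCoeff θ p t l * coeff θ p (t - (l : ℤ)) (i - l)
      = if i = 0 then 1 else 0 := by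
  cases i with
  | zero => simp [invCoeff, coeff]
  | succ i =>
    rw [Finset.sum_range_succ, Finset.sum_range]
    conv_lhs => rw [invCoeff]
    simp [coeff]

/-- The trajectory of the scheduling processes at the outcome `ω`. -/
def traj {Ω : Type*} {np : ℕ} (p : Fin np → ℤ → Ω → ℝ) (ω : Ω) : Fin np → ℤ → ℝ :=
  fun i t => p i t ω

/-- The output of the pure moving-average system, `y(t) = ∑_{j ≤ n} C_j(p, t) e(t - j)`. -/
def output {Ω : Type*} {np ny n : ℕ} (h : Param np ny n) (p : Fin np → ℤ → Ω → ℝ)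
    (e : ℤ → Ω → Fin ny → ℝ) (t : ℤ) (ω : Ω) : Fin ny → ℝ :=
  ∑ j ∈ Finset.range (n + 1), (coeff h (traj p ω) t j).mulVec (e (t - (j : ℤ)) ω)

/-- The prediction error `ε(θ, t) = ∑_{i ≥ 0} Γ_i(θ, p, t) y(t - i)`. -/
def predError {Ω : Type*} {np ny n m : ℕ} (h : Param np ny n) (p : Fin np → ℤ → Ω → ℝ)
    (e : ℤ → Ω → Fin ny → ℝ) (θ : Param np ny m) (t : ℤ) (ω : Ω) : Fin ny → ℝ :=
  ∑' i : ℕ, (invCoeff θ (traj p ω) t i).mulVec (output h p e (t - (i : ℤ)) ω)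

/-- The average `(1/N) ∑_{t = 1}^N Tr E{ε(θ, t) ε(θ, t)ᵀ}`. -/
def avgLoss {Ω : Type*} [MeasurableSpace Ω] {np ny n m : ℕ} (μ : Measure Ω) (h : Param np ny n)
    (p : Fin np → ℤ → Ω → ℝ) (e : ℤ → Ω → Fin ny → ℝ) (θ : Param np ny m) (N : ℕ) : ℝ :=
  (1 / (N : ℝ)) * ∑ t ∈ Finset.Icc 1 N, Matrix.trace (Matrix.of fun a b : Fin ny =>
    ∫ ω, predError h p e θ (t : ℤ) ω a * predError h p e θ (t : ℤ) ω b ∂μ)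

/-- The asymptotic loss: the limit of `avgLoss` as `N → ∞`. -/
def loss {Ω : Type*} [MeasurableSpace Ω] {np ny n m : ℕ} (μ : Measure Ω) (h : Param np ny n)
    (p : Fin np → ℤ → Ω → ℝ) (e : ℤ → Ω → Fin ny → ℝ) (θ : Param np ny m) : ℝ :=
  limUnder atTop (avgLoss μ h p e θ)

/-- The parameters of filters with a stable inverse in the mean-square sense:
`∑_i E ‖Γ_i(θ, p, t)‖² < ∞` (Frobenius norm). -/
def stableSet {Ω : Type*} [MeasurableSpace Ω] {np : ℕ} (ny n : ℕ) (μ : Measure Ω)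
    (p : Fin np → ℤ → Ω → ℝ) : Set (Param np ny n) :=
  {θ | ∀ t : ℤ, Summable fun i : ℕ =>
    ∫ ω, ∑ a : Fin ny, ∑ b : Fin ny, (invCoeff θ (traj p ω) t i a b) ^ 2 ∂μ}

/-- All partial derivatives of `V` exist and vanish at `θ`. -/
def IsStationary {ι : Type*} [DecidableEq ι] (V : (ι → ℝ) → ℝ) (θ : ι → ℝ) : Prop :=
  ∀ x : ι, HasDerivAt (fun s : ℝ => V (Function.update θ x s)) 0 (θ x)

/-- `e` is an i.i.d. sequence with law `N(0, S)`. -/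
structure IsGaussianNoise {Ω : Type*} [MeasurableSpace Ω] {ny : ℕ} (μ : Measure Ω)
    (e : ℤ → Ω → Fin ny → ℝ) (S : Matrix (Fin ny) (Fin ny) ℝ) : Prop where
  measurable : ∀ t, Measurable (e t)
  indep : iIndepFun e μ
  gaussian : ∀ t, HasGaussianLaw (e t) μ
  mean : ∀ t a, ∫ ω, e t ω a ∂μ = 0
  cov : ∀ t a b, ∫ ω, e t ω a * e t ω b ∂μ = S a b

/-- The condition on the scheduling processes: the `p_i` are zero-mean white noise processes
(independent and identically distributed in time) with positive finite variance, mutually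
independent, independent of `e`, with finite moments of orders `2, …, M`. -/
structure IsSchedulingNoise {Ω : Type*} [MeasurableSpace Ω] {np ny : ℕ} (μ : Measure Ω)
    (p : Fin np → ℤ → Ω → ℝ) (e : ℤ → Ω → Fin ny → ℝ) (M : ℕ) : Prop where
  measurable : ∀ i t, Measurable (p i t)
  indep : iIndepFun (fun x : Fin np × ℤ => p x.1 x.2) μ
  identDistrib : ∀ i s t, IdentDistrib (p i s) (p i t) μ μ
  mean : ∀ i t, ∫ ω, p i t ω ∂μ = 0
  variance_pos : ∀ i t, 0 < ∫ ω, (p i t ω) ^ 2 ∂μ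
  moments : ∀ i j t k l, 2 ≤ k + l → k + l ≤ M →
    Integrable (fun ω => (p i t ω) ^ k * (p j t ω) ^ l) μ
  indep_noise : IndepFun (fun ω (x : Fin np × ℤ) => p x.1 x.2 ω) (fun ω t => e t ω) μ

end LPVMA

end

open LPVMA

/-! In observer canonical form the filter is `C_{j+1}(t) = c(p_t) A(p_{t-1}) ⋯ A(p_{t-j})
K(p_{t-1-j})`, where `c`, `A`, `K` are linear in the scheduling vector. The matrices `c` and `A` are
fixed, and the parameters enter only through the gain `K = K_θ`, which is linear in `θ` and can be
any matrix family (`coeff_succ`, `gainMat_paramOfGain`). Inversion replaces `A` by `M = A - K_θ c`,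
so the filter from `e` to `ε` has the coefficients `I` and `c M ⋯ M (K_h - K_θ)`
(`sum_invCoeff_mul_coeff`).

The scheduling is white, so second moments of such products are products of second-moment matrices.
With `T(θ) = E[M ⊗ M]`, `G` the second moment of `K_h - K_θ` and `Y(θ)` the sum over `k` of the
forms `v ↦ E‖c M ⋯ M v‖²` with `k` factors `M`, the loss is `tr S + ⟨Y(θ), G S⟩`. In terms of the
state-error covariance `Δ(θ)`, which solves `Δ = T(θ) Δ + G S`, the excess over `tr S` is the trace
of `E[c Δ cᵀ]`, hence nonnegative, and it vanishes at `θ = h`.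

Mean-square invertibility is equivalent to `T(θ)^k → 0` (`mem_stableSet_iff`), which gives openness
and, by inversion of `1 - T`, differentiability. The hard direction starts from finite energy of the
gain directions. Since `A` is nilpotent and `M v` differs from `A v` by gain directions, the energy
of every state is finite (`summable_qf_costate`). Hence `Y` exists, and it is positive definite by
observability (`eq_zero_of_qf_costate`). The tails `Y T^k` tend to zero and control `T^k`.

Uniqueness of the stationary point is a policy-improvement argument. The loss difference is exactly
`⟨Y(θ'), T(θ') Δ(θ) + G(h - θ') S - Δ(θ)⟩` (`momLoss_sub_momLoss`), so the derivative along `v`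
pairs `Y(θ)` with the first-order part of a quadratic in the gain. That part is linear in the gain
of `v`. Taking its own coefficient as the gain of `v`, stationarity and definiteness of `Y` force
the coefficient to vanish (`mixVec_eq_zero`). The full step from `θ` to `h` then has no linear term,
so `T(h) Δ = Δ + (nonnegative) ≥ Δ`. Iteration and stability of `h` give `Δ ≤ T(h)^k Δ → 0`, so `Δ =
0`; definiteness of `S` yields `K_h = K_θ` (`eq_of_stationary`). A minimizer is an interior point of
the open parameter set, hence stationary, so it is unique as well. -/

/-! ### Observer canonical form of a moving-average filter -/

namespace LPVMA

/-- State coordinates of the observer canonical form: a nonempty string of at most `n` characters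
and an output channel. -/
abbrev StateIdx (np ny n : ℕ) : Type :=
  ((k : Fin n) × (Fin (k.val + 1) → Fin (np + 1))) × Fin ny

section Realization

variable {np ny n : ℕ}

/-- The state coordinate whose string is extended by the character `x`, if it is not too long. -/
def nextIdx (x : Fin (np + 1)) (i : StateIdx np ny n) : Option (StateIdx np ny n) :=
  if hk : i.1.1.val + 1 < n then
    some (⟨⟨i.1.1.val + 1, hk⟩, Fin.snoc (α := fun _ => Fin (np + 1)) i.1.2 x⟩, i.2)
  else none

/-- The state coordinate of the one-character string `x` and the channel `a`. -/
def firstIdx (x : Fin (np + 1)) (a : Fin ny) : Option (StateIdx np ny n) :=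
  if hk : 0 < n then some (⟨⟨0, hk⟩, fun _ => x⟩, a) else none

/-- The transition matrix of the character `x`. -/
def shiftMat (ny n : ℕ) (x : Fin (np + 1)) : Matrix (StateIdx np ny n) (StateIdx np ny n) ℝ :=
  Matrix.of fun i j => if nextIdx x i = some j then 1 else 0

/-- The output matrix of the character `x`. -/
def outMat (ny n : ℕ) (x : Fin (np + 1)) : Matrix (Fin ny) (StateIdx np ny n) ℝ :=
  Matrix.of fun a j => if firstIdx x a = some j then 1 else 0

/-- The input gain of the character `x`: the sub-Markov parameters of the strings ending in `x`. -/
def gainMat (θ : Param np ny n) (x : Fin (np + 1)) : Matrix (StateIdx np ny n) (Fin ny) ℝ :=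
  Matrix.of fun i b => θ (⟨i.1.1, Fin.snoc (α := fun _ => Fin (np + 1)) i.1.2 x⟩, i.2, b)

/-- The parameter vector with prescribed gains. -/
def paramOfGain (G : Fin (np + 1) → Matrix (StateIdx np ny n) (Fin ny) ℝ) : Param np ny n :=
  fun y => G (y.1.2 (Fin.last _)) (⟨y.1.1, Fin.init y.1.2⟩, y.2.1) y.2.2

theorem gainMat_paramOfGain (G : Fin (np + 1) → Matrix (StateIdx np ny n) (Fin ny) ℝ) :
    gainMat (paramOfGain G) = G := by
  funext x
  ext i b
  obtain ⟨⟨k, ζ⟩, a⟩ := i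
  simp [gainMat, paramOfGain]

theorem paramOfGain_gainMat (θ : Param np ny n) : paramOfGain (gainMat θ) = θ := by
  funext y
  obtain ⟨⟨k, η⟩, a, b⟩ := y
  simp [gainMat, paramOfGain]

theorem gainMat_injective : Function.Injective (gainMat (np := np) (ny := ny) (n := n)) :=
  Function.LeftInverse.injective paramOfGain_gainMat

theorem shiftMat_mulVec (x : Fin (np + 1)) (v : StateIdx np ny n → ℝ) (i : StateIdx np ny n) :
    (shiftMat ny n x).mulVec v i = (nextIdx x i).elim 0 v := by
  cases h : nextIdx x i <;> simp [shiftMat, Matrix.mulVec, dotProduct, h]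

theorem outMat_mulVec (x : Fin (np + 1)) (v : StateIdx np ny n → ℝ) (a : Fin ny) :
    (outMat ny n x).mulVec v a = (firstIdx x a).elim 0 v := by
  cases h : (firstIdx x a : Option (StateIdx np ny n)) <;>
    simp [outMat, Matrix.mulVec, dotProduct, h]

end Realization

/-- The linear combination of the matrices `B x` with coefficients `w x`. -/
def lin {A κ ι : Type*} [Fintype A] (B : A → Matrix κ ι ℝ) (w : A → ℝ) : Matrix κ ι ℝ :=
  ∑ x, w x • B x

theorem lin_mulVec {A κ ι : Type*} [Fintype A] [Fintype ι] (B : A → Matrix κ ι ℝ) (w : A → ℝ)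
    (v : ι → ℝ) : (lin B w).mulVec v = ∑ x, w x • (B x).mulVec v := by
  simp [lin, Matrix.sum_mulVec, Matrix.smul_mulVec]

theorem lin_apply {A κ ι : Type*} [Fintype A] (B : A → Matrix κ ι ℝ) (w : A → ℝ) (i : κ) (j : ι) :
    lin B w i j = ∑ x, w x * B x i j := by
  simp [lin, Matrix.sum_apply]

/-- The product `B(q(t)) B(q(t - 1)) ⋯ B(q(t - k + 1))` along a trajectory `q`. -/
def prodFrom {A ι : Type*} [Fintype ι] [DecidableEq ι] (B : (A → ℝ) → Matrix ι ι ℝ)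
    (q : ℤ → A → ℝ) (t : ℤ) : ℕ → Matrix ι ι ℝ
  | 0 => 1
  | k + 1 => prodFrom B q t k * B (q (t - (k : ℤ)))

/-- The vector `(1, p_1(t), …, p_{np}(t))`. -/
def schedVec {np : ℕ} (p : Fin np → ℤ → ℝ) (t : ℤ) : Fin (np + 1) → ℝ := fun a => sched p a t

/-- The error transition matrix of the predictor as a function of the scheduling vector. -/
def errMat {np ny n : ℕ} (θ : Param np ny n) (w : Fin (np + 1) → ℝ) :
    Matrix (StateIdx np ny n) (StateIdx np ny n) ℝ :=
  lin (shiftMat ny n) w - lin (gainMat θ) w * lin (outMat ny n) w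

/-! ### The filter and its inverse along a fixed scheduling trajectory -/

section Pathwise

variable {np ny n : ℕ}

theorem schedProd_snoc {m : ℕ} (p : Fin np → ℤ → ℝ) (ζ : Fin m → Fin (np + 1))
    (x : Fin (np + 1)) (t : ℤ) :
    schedProd p (Fin.snoc (α := fun _ => Fin (np + 1)) ζ x) t
      = schedProd p ζ t * sched p x (t - m) := by
  simp [schedProd, Fin.prod_univ_castSucc]

theorem sum_snoc {m : ℕ} (f : (Fin (m + 1) → Fin (np + 1)) → ℝ) :
    ∑ η, f η = ∑ ζ : Fin m → Fin (np + 1), ∑ x,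
      f (Fin.snoc (α := fun _ => Fin (np + 1)) ζ x) := by
  rw [← (Fin.snocEquiv fun _ : Fin (m + 1) => Fin (np + 1)).sum_comp, Fintype.sum_prod_type,
    Finset.sum_comm]
  rfl

/-- The output matrix chooses the first character of a string, and each shift appends one more,
weighted by the scheduling signal at its own time. The product therefore runs through all strings of
length `m + 1`; there are no coordinates for strings longer than `n`. -/
theorem outMat_prodFrom_mulVec (p : Fin np → ℤ → ℝ) (s : ℤ) (m : ℕ) (v : StateIdx np ny n → ℝ)
    (a : Fin ny) :
    (lin (outMat ny n) (schedVec p s) * prodFrom (lin (shiftMat ny n)) (schedVec p) (s - 1) m).mulVec v a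
      = if hm : m < n then
          ∑ ζ : Fin (m + 1) → Fin (np + 1), schedProd p ζ s * v (⟨⟨m, hm⟩, ζ⟩, a)
        else 0 := by
  induction m generalizing v with
  | zero =>
    simp only [prodFrom, lin_mulVec, Finset.sum_apply, Pi.smul_apply, outMat_mulVec,
      smul_eq_mul, firstIdx, Matrix.mul_one]
    split_ifs with h
    · rw [sum_snoc, Fintype.sum_eq_single (fun i => i.elim0) (fun ζ h => absurd
        (funext fun i => i.elim0) h)]
      refine Finset.sum_congr rfl fun x _ => ?_
      rw [schedProd_snoc]
      simp only [schedProd, Finset.univ_eq_empty, Finset.prod_empty, schedVec, one_mul,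
        Option.elim_some, Nat.cast_zero, sub_zero]
      congr 3
    · simp
  | succ m ih =>
    rw [prodFrom, ← Matrix.mul_assoc, ← Matrix.mulVec_mulVec, ih]
    by_cases h : m + 1 < n
    · rw [dif_pos (Nat.lt_of_succ_lt h), dif_pos h,
        sum_snoc (fun η => schedProd p η s * v (⟨⟨m + 1, h⟩, η⟩, a))]
      refine Finset.sum_congr rfl fun ζ _ => ?_
      rw [lin_mulVec, Finset.sum_apply, Finset.mul_sum]
      refine Finset.sum_congr rfl fun x _ => ?_
      rw [Pi.smul_apply, shiftMat_mulVec, schedProd_snoc]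
      simp only [nextIdx, h, dif_pos, Option.elim_some, schedVec, smul_eq_mul, mul_assoc]
      congr 3
      push_cast
      ring
    · rw [dif_neg h]
      split_ifs with hm
      · refine Finset.sum_eq_zero fun ζ _ => ?_
        rw [lin_mulVec, Finset.sum_apply, Finset.sum_eq_zero, mul_zero]
        intro x _
        rw [Pi.smul_apply, shiftMat_mulVec]
        simp [nextIdx, h]
      · rfl

theorem mul_apply_eq_mulVec {κ ι ν : Type*} [Fintype ι] (B : Matrix κ ι ℝ) (D : Matrix ι ν ℝ)
    (a : κ) (b : ν) : (B * D) a b = B.mulVec (fun i => D i b) a := rfl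

/-- The observer canonical form realizes the filter. -/
theorem coeff_succ (θ : Param np ny n) (p : Fin np → ℤ → ℝ) (t : ℤ) (j : ℕ) :
    coeff θ p t (j + 1) = lin (outMat ny n) (schedVec p t)
      * prodFrom (lin (shiftMat ny n)) (schedVec p) (t - 1) j
      * lin (gainMat θ) (schedVec p (t - 1 - (j : ℤ))) := by
  ext a b
  rw [mul_apply_eq_mulVec, outMat_prodFrom_mulVec, coeff]
  split_ifs with h
  · rw [Matrix.sum_apply, sum_snoc]
    refine Finset.sum_congr rfl fun ζ _ => ?_
    rw [lin_apply, Finset.mul_sum]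
    refine Finset.sum_congr rfl fun x _ => ?_
    rw [Matrix.smul_apply, schedProd_snoc]
    simp only [gainMat, Matrix.of_apply, smul_eq_mul, schedVec, mul_assoc]
    congr 3
    push_cast
    ring
  · rfl

/-- The impulse response of the predictor error to its initial state. -/
def errResp (θ : Param np ny n) (q : ℤ → Fin (np + 1) → ℝ) (t : ℤ) (k : ℕ) :
    Matrix (Fin ny) (StateIdx np ny n) ℝ :=
  lin (outMat ny n) (q t) * prodFrom (errMat θ) q (t - 1) k

/-- The two identities need a joint induction: the first at `k` gives the second at `k`, which in
turn gives the first at `k + 1`. -/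
theorem errResp_eq_and_invCoeff_succ (θ : Param np ny n) (p : Fin np → ℤ → ℝ) (t : ℤ) (k : ℕ) :
    errResp θ (schedVec p) t k = ∑ l ∈ Finset.range (k + 1), invCoeff θ p t l
        * (lin (outMat ny n) (schedVec p (t - (l : ℤ)))
          * prodFrom (lin (shiftMat ny n)) (schedVec p) (t - (l : ℤ) - 1) (k - l)) ∧
      invCoeff θ p t (k + 1) = -(errResp θ (schedVec p) t k
        * lin (gainMat θ) (schedVec p (t - 1 - (k : ℤ)))) := by
  -- Every `C_{k+1-l}(t - l)` ends in the gain at the same time `t - 1 - k`, which therefore factors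
  -- out of the recursion for `Γ_{k+1}`.
  have key : ∀ k, errResp θ (schedVec p) t k = ∑ l ∈ Finset.range (k + 1), invCoeff θ p t l
        * (lin (outMat ny n) (schedVec p (t - (l : ℤ)))
          * prodFrom (lin (shiftMat ny n)) (schedVec p) (t - (l : ℤ) - 1) (k - l)) →
      invCoeff θ p t (k + 1) = -(errResp θ (schedVec p) t k
        * lin (gainMat θ) (schedVec p (t - 1 - (k : ℤ)))) := by
    intro k hk
    rw [invCoeff, hk, Matrix.sum_mul, Finset.sum_range]
    congr 1
    refine Finset.sum_congr rfl fun l _ => ?_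
    have hl : l.val ≤ k := Nat.lt_succ_iff.mp l.isLt
    rw [Nat.succ_sub hl, coeff_succ, Matrix.mul_assoc, Matrix.mul_assoc, Matrix.mul_assoc]
    have : (t - (l.val : ℤ) - 1 - ((k - l.val : ℕ) : ℤ)) = t - 1 - k := by
      rw [Nat.cast_sub hl]; ring
    rw [this]
  have main : errResp θ (schedVec p) t k = ∑ l ∈ Finset.range (k + 1), invCoeff θ p t l
        * (lin (outMat ny n) (schedVec p (t - (l : ℤ)))
          * prodFrom (lin (shiftMat ny n)) (schedVec p) (t - (l : ℤ) - 1) (k - l)) := by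
    induction k with
    | zero => simp [errResp, prodFrom, invCoeff]
    | succ k ih =>
      -- Split the last factor `M = A - K c` and replace the response times `K` by `-Γ_{k+1}`.
      have h1 : errResp θ (schedVec p) t (k + 1) = errResp θ (schedVec p) t k
          * lin (shiftMat ny n) (schedVec p (t - 1 - (k : ℤ)))
          + invCoeff θ p t (k + 1) * lin (outMat ny n) (schedVec p (t - 1 - (k : ℤ))) := by
        rw [key k ih, errResp, prodFrom, errMat, ← Matrix.mul_assoc, Matrix.mul_sub, errResp,
          Matrix.neg_mul, ← sub_eq_add_neg, Matrix.mul_assoc _ (lin (gainMat θ) _)]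
      rw [h1, ih, Finset.sum_range_succ _ (k + 1), Matrix.sum_mul]
      congr 1
      · refine Finset.sum_congr rfl fun l hl => ?_
        have hl : l ≤ k := Nat.lt_succ_iff.mp (Finset.mem_range.mp hl)
        rw [Nat.succ_sub hl, prodFrom, Matrix.mul_assoc, Matrix.mul_assoc]
        have : (t - (l : ℤ) - 1 - ((k - l : ℕ) : ℤ)) = t - 1 - k := by
          rw [Nat.cast_sub hl]; ring
        rw [this]
      · simp only [Nat.sub_self, prodFrom, Matrix.mul_one]
        congr 3
        push_cast
        ring
  exact ⟨main, key k main⟩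

theorem invCoeff_succ (θ : Param np ny n) (p : Fin np → ℤ → ℝ) (t : ℤ) (k : ℕ) :
    invCoeff θ p t (k + 1) = -(errResp θ (schedVec p) t k
        * lin (gainMat θ) (schedVec p (t - 1 - (k : ℤ)))) :=
  (errResp_eq_and_invCoeff_succ θ p t k).2

theorem gainMat_sub (θ θ' : Param np ny n) : gainMat (θ - θ') = gainMat θ - gainMat θ' := rfl

theorem lin_sub {A κ ι : Type*} [Fintype A] (B B' : A → Matrix κ ι ℝ) (w : A → ℝ) :
    lin (B - B') w = lin B w - lin B' w := by
  simp [lin, smul_sub]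

/-- The product of the inverse of one filter with another filter. -/
theorem sum_invCoeff_mul_coeff (θ h : Param np ny n) (p : Fin np → ℤ → ℝ) (t : ℤ) (k : ℕ) :
    ∑ l ∈ Finset.range (k + 1 + 1), invCoeff θ p t l * coeff h p (t - (l : ℤ)) (k + 1 - l)
      = errResp θ (schedVec p) t k * lin (gainMat (h - θ)) (schedVec p (t - 1 - (k : ℤ))) := by
  -- The term `l = k + 1` is `Γ_{k+1}` and supplies the gain of `-θ`; the remaining terms supply the
  -- gain of `h`.
  rw [Finset.sum_range_succ, Nat.sub_self, invCoeff_succ, gainMat_sub, lin_sub, Matrix.mul_sub,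
    coeff, Matrix.mul_one, ← sub_eq_add_neg]
  congr 1
  rw [(errResp_eq_and_invCoeff_succ θ p t k).1, Matrix.sum_mul]
  refine Finset.sum_congr rfl fun l hl => ?_
  have hl : l ≤ k := Nat.lt_succ_iff.mp (Finset.mem_range.mp hl)
  rw [Nat.succ_sub hl, coeff_succ, Matrix.mul_assoc, Matrix.mul_assoc, Matrix.mul_assoc]
  have : (t - (l : ℤ) - 1 - ((k - l : ℕ) : ℤ)) = t - 1 - k := by
    rw [Nat.cast_sub hl]; ring
  rw [this]

theorem coeff_extend {m : ℕ} (hm : n ≤ m) (θ : Param np ny n) (p : Fin np → ℤ → ℝ) (t : ℤ)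
    (j : ℕ) : coeff (extend m θ) p t j = coeff θ p t j := by
  cases j with
  | zero => rfl
  | succ j =>
    rw [coeff, coeff]
    by_cases hj : j < n
    · rw [dif_pos hj, dif_pos (hj.trans_le hm)]
      refine Finset.sum_congr rfl fun η _ => ?_
      congr 1
      ext a b
      simp [extend, hj]
    · rw [dif_neg hj]
      split_ifs with h
      · refine Finset.sum_eq_zero fun η _ => ?_
        ext a b
        simp [extend, hj]
      · rfl

theorem invCoeff_extend {m : ℕ} (hm : n ≤ m) (θ : Param np ny n) (p : Fin np → ℤ → ℝ) (t : ℤ)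
    (i : ℕ) : invCoeff (extend m θ) p t i = invCoeff θ p t i := by
  induction i using Nat.strong_induction_on with
  | _ i ih =>
    cases i with
    | zero => simp [invCoeff]
    | succ i =>
      rw [invCoeff, invCoeff]
      congr 1
      refine Finset.sum_congr rfl fun l _ => ?_
      rw [ih l (by omega), coeff_extend hm]

end Pathwise

end LPVMA

namespace LPVMA

/-! ### Structural properties of the observer canonical form -/

section Structure

variable {np ny n : ℕ}

/-- The coordinate `ζ` of a vector shifted by `x` is the coordinate `ζx` of the original. Each shift
thus lowers the maximal length of the strings in the support, and `n` shifts annihilate everything.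
-/
theorem shiftMat_induction (P : (StateIdx np ny n → ℝ) → Prop) (h0 : P 0)
    (hstep : ∀ v, (∀ x, P ((shiftMat ny n x).mulVec v)) → P v) (v : StateIdx np ny n → ℝ) :
    P v := by
  have key : ∀ m : ℕ, ∀ v : StateIdx np ny n → ℝ, (∀ i, m ≤ i.1.1.val → v i = 0) → P v := by
    intro m
    induction m with
    | zero =>
      intro v hv
      have : v = 0 := funext fun i => hv i (Nat.zero_le _)
      exact this ▸ h0
    | succ m ih =>
      intro v hv
      refine hstep v fun x => ih _ fun i hi => ?_
      rw [shiftMat_mulVec]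
      by_cases h : i.1.1.val + 1 < n
      · simp only [nextIdx, h, dif_pos, Option.elim_some]
        exact hv _ (Nat.succ_le_succ hi)
      · simp [nextIdx, h]
  exact key n v fun i hi => absurd i.1.1.isLt (not_lt.mpr hi)

/-- The coordinate of a string is recovered by shifting off its characters from the last one down
and reading the first one with the output matrix. -/
theorem eq_zero_of_unobservable (P : (StateIdx np ny n → ℝ) → Prop)
    (hP : ∀ v, P v → (∀ x, (outMat ny n x).mulVec v = 0) ∧ ∀ x, P ((shiftMat ny n x).mulVec v))
    (v : StateIdx np ny n → ℝ) (hv : P v) : v = 0 := by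
  have key : ∀ m : ℕ, ∀ v : StateIdx np ny n → ℝ, P v → ∀ (hm : m < n)
      (ζ : Fin (m + 1) → Fin (np + 1)) (a : Fin ny), v (⟨⟨m, hm⟩, ζ⟩, a) = 0 := by
    intro m
    induction m with
    | zero =>
      intro v hv hm ζ a
      have h := congrFun ((hP v hv).1 (ζ 0)) a
      rw [outMat_mulVec] at h
      simp only [firstIdx, hm, dif_pos, Option.elim_some, Pi.zero_apply] at h
      rw [← h]
      congr 3
      funext i
      rw [show i = 0 from Subsingleton.elim (α := Fin 1) i 0]
    | succ m ih =>
      intro v hv hm ζ a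
      have h := ih _ ((hP v hv).2 (ζ (Fin.last _))) (Nat.lt_of_succ_lt hm) (Fin.init ζ) a
      rw [shiftMat_mulVec] at h
      simpa only [nextIdx, hm, dif_pos, Option.elim_some, Fin.snoc_init_self] using h
  funext i
  exact key _ v hv i.1.1.isLt i.1.2 i.2

end Structure

/-! ### Quadratic forms and second moments of random matrices -/

section QuadraticForm

variable {κ ι : Type*} [Fintype κ] [Fintype ι]

/-- The quadratic form `vᵀ X v` of a matrix given as a function on pairs. -/
def qf (X : κ × κ → ℝ) (v : κ → ℝ) : ℝ := ∑ i, ∑ j, v i * X (i, j) * v j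

/-- The identity matrix as a function on pairs. -/
def vecOne (κ : Type*) [DecidableEq κ] : κ × κ → ℝ := fun x => if x.1 = x.2 then 1 else 0

theorem qf_vecOne [DecidableEq κ] (v : κ → ℝ) : qf (vecOne κ) v = ∑ i, v i ^ 2 := by
  simp [qf, vecOne, sq]

theorem qf_add (X Y : κ × κ → ℝ) (v : κ → ℝ) : qf (X + Y) v = qf X v + qf Y v := by
  simp [qf, mul_add, add_mul, Finset.sum_add_distrib]

theorem qf_zero_right (X : κ × κ → ℝ) : qf X 0 = 0 := by simp [qf]

theorem qf_smul_right (X : κ × κ → ℝ) (c : ℝ) (v : κ → ℝ) : qf X (c • v) = c ^ 2 * qf X v := by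
  simp only [qf, Finset.mul_sum, Pi.smul_apply, smul_eq_mul]
  exact Finset.sum_congr rfl fun i _ => Finset.sum_congr rfl fun j _ => by ring

theorem qf_add_add_sub (X : κ × κ → ℝ) (u v : κ → ℝ) :
    qf X (u + v) + qf X (u - v) = 2 * qf X u + 2 * qf X v := by
  simp only [qf, Finset.mul_sum, ← Finset.sum_add_distrib, Pi.add_apply, Pi.sub_apply]
  exact Finset.sum_congr rfl fun i _ => Finset.sum_congr rfl fun j _ => by ring

theorem qf_add_le {X : κ × κ → ℝ} (hX : ∀ v, 0 ≤ qf X v) (u v : κ → ℝ) :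
    qf X (u + v) ≤ 2 * qf X u + 2 * qf X v := by
  linarith [qf_add_add_sub X u v, hX (u - v)]

theorem qf_sub_le {X : κ × κ → ℝ} (hX : ∀ v, 0 ≤ qf X v) (u v : κ → ℝ) :
    qf X (u - v) ≤ 2 * qf X u + 2 * qf X v := by
  linarith [qf_add_add_sub X u v, hX (u + v)]

/-- The factor `2 ^ s.card` is crude; what matters is that it does not depend on `X`. -/
theorem qf_sum_le {X : κ × κ → ℝ} (hX : ∀ v, 0 ≤ qf X v) {Z : Type*} (s : Finset Z)
    (r : Z → κ → ℝ) : qf X (∑ z ∈ s, r z) ≤ 2 ^ s.card * ∑ z ∈ s, qf X (r z) := by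
  classical
  induction s using Finset.induction_on with
  | empty => simp [qf_zero_right]
  | insert z s hz ih =>
    rw [Finset.sum_insert hz, Finset.sum_insert hz, Finset.card_insert_of_notMem hz]
    have h1 := qf_add_le hX (r z) (∑ z ∈ s, r z)
    have h2 : (1 : ℝ) ≤ 2 ^ s.card := one_le_pow₀ (by norm_num)
    have h3 : 1 * qf X (r z) ≤ 2 ^ s.card * qf X (r z) :=
      mul_le_mul_of_nonneg_right h2 (hX _)
    rw [pow_succ]
    linarith

theorem qf_single [DecidableEq κ] (X : κ × κ → ℝ) (i : κ) : qf X (Pi.single i 1) = X (i, i) := by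
  simp [qf, Pi.single_apply]

theorem qf_single_add_single [DecidableEq κ] (X : κ × κ → ℝ) (i j : κ) :
    qf X (Pi.single i 1 + Pi.single j 1) = X (i, i) + X (j, j) + X (i, j) + X (j, i) := by
  simp [qf, Pi.single_apply, add_mul, mul_add, Finset.sum_add_distrib]
  ring

theorem hasSum_qf {y : ℕ → κ × κ → ℝ} {Y : κ × κ → ℝ} (h : HasSum y Y) (v : κ → ℝ) :
    HasSum (fun k => qf (y k) v) (qf Y v) := by
  refine hasSum_sum fun i _ => hasSum_sum fun j _ => ?_
  exact ((Pi.hasSum.mp h (i, j)).mul_left _).mul_right _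

/-- Polarization expresses the entries of a symmetric form by its values. -/
theorem summable_of_summable_qf {y : ℕ → κ × κ → ℝ} (hsymm : ∀ k i j, y k (i, j) = y k (j, i))
    (h : ∀ v, Summable fun k => qf (y k) v) : Summable y := by
  classical
  refine Pi.summable.mpr fun x => ?_
  obtain ⟨i, j⟩ := x
  have h1 := (((h (Pi.single i 1 + Pi.single j 1)).sub (h (Pi.single i 1))).sub
    (h (Pi.single j 1))).mul_left (1 / 2)
  refine h1.congr fun k => ?_
  rw [qf_single_add_single, qf_single, qf_single, hsymm k j i]
  ring

theorem continuous_qf (X : κ × κ → ℝ) : Continuous (qf X) := by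
  unfold qf
  fun_prop

/-- A positive definite form dominates a multiple of the sum of squares. -/
theorem exists_pos_mul_le_qf {X : κ × κ → ℝ} (hX : ∀ v, 0 ≤ qf X v) (hX0 : ∀ v, qf X v = 0 → v = 0) :
    ∃ c : ℝ, 0 < c ∧ ∀ v : κ → ℝ, c * ∑ i, v i ^ 2 ≤ qf X v := by
  classical
  have hcont : Continuous fun v : κ → ℝ => ∑ i, v i ^ 2 := by fun_prop
  let K : Set (κ → ℝ) := {v | ∑ i, v i ^ 2 = 1}
  have hK : IsCompact K := by
    refine Metric.isCompact_of_isClosed_isBounded (isClosed_eq hcont continuous_const) ?_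
    refine (Metric.isBounded_iff_subset_closedBall 0).mpr ⟨1, fun v hv => ?_⟩
    rw [mem_closedBall_zero_iff, pi_norm_le_iff_of_nonneg zero_le_one]
    intro i
    rw [Real.norm_eq_abs, abs_le_one_iff_mul_self_le_one, ← sq]
    have hv' : ∑ i, v i ^ 2 = 1 := hv
    rw [← hv']
    exact Finset.single_le_sum (f := fun i => v i ^ 2) (fun j _ => sq_nonneg _)
      (Finset.mem_univ i)
  have hscale : ∀ c : ℝ, (∀ v ∈ K, c ≤ qf X v) → ∀ v : κ → ℝ, c * ∑ i, v i ^ 2 ≤ qf X v := by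
    intro c hc v
    rcases (Finset.sum_nonneg fun i (_ : i ∈ Finset.univ) => sq_nonneg (v i)).eq_or_lt with h | h
    · rw [← h, mul_zero]
      exact hX v
    · set s := ∑ i, v i ^ 2 with hs
      have hmem : (Real.sqrt s)⁻¹ • v ∈ K := by
        show ∑ i, ((Real.sqrt s)⁻¹ • v) i ^ 2 = 1
        simp only [Pi.smul_apply, smul_eq_mul, mul_pow, inv_pow, Real.sq_sqrt h.le]
        rw [← Finset.mul_sum, ← hs, inv_mul_cancel₀ h.ne']
      have h1 := hc _ hmem
      rw [qf_smul_right, inv_pow, Real.sq_sqrt h.le, inv_mul_eq_div, le_div_iff₀ h] at h1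
      exact h1
  -- The unit sphere is empty when there are no coordinates; any positive constant serves then.
  rcases K.eq_empty_or_nonempty with hE | hne
  · exact ⟨1, one_pos, hscale 1 fun v hv => absurd hv (hE ▸ Set.notMem_empty v)⟩
  · obtain ⟨v₀, hv₀, hmin⟩ := hK.exists_isMinOn hne (continuous_qf X).continuousOn
    refine ⟨qf X v₀, lt_of_le_of_ne (hX v₀) fun h => ?_, hscale _ fun v hv => hmin hv⟩
    have h0 := hX0 v₀ h.symm
    have h1 : ∑ i, v₀ i ^ 2 = 1 := hv₀
    simp [h0] at h1

end QuadraticForm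

/-! ### Second moments of random matrices acting on quadratic forms -/

section Moments

variable {Ω : Type*} [MeasurableSpace Ω] {μ : Measure Ω} {κ ι ν : Type*}

/-- The entries of a random matrix are square integrable. -/
def L2Mat (μ : Measure Ω) (B : Ω → Matrix κ ι ℝ) : Prop :=
  ∀ i j, MemLp (fun ω => B ω i j) 2 μ

/-- The mixed second moment `E[B ⊗ B']` of random matrices. -/
noncomputable def mom₂ (μ : Measure Ω) (B B' : Ω → Matrix κ ι ℝ) : Matrix (κ × κ) (ι × ι) ℝ :=
  Matrix.of fun x y => ∫ ω, B ω x.1 y.1 * B' ω x.2 y.2 ∂μ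

/-- The second moment `E[B ⊗ B]` of a random matrix. -/
noncomputable def mom (μ : Measure Ω) (B : Ω → Matrix κ ι ℝ) : Matrix (κ × κ) (ι × ι) ℝ := mom₂ μ B B

theorem mom_apply (B : Ω → Matrix κ ι ℝ) (x : κ × κ) (y : ι × ι) :
    mom μ B x y = ∫ ω, B ω x.1 y.1 * B ω x.2 y.2 ∂μ := rfl

theorem mom_swap (B : Ω → Matrix κ ι ℝ) (i j : κ) (k l : ι) :
    mom μ B (i, j) (k, l) = mom μ B (j, i) (l, k) := by
  simp only [mom_apply, mul_comm]

variable [Fintype κ] [Fintype ι]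

theorem integrable_qf (X : κ × κ → ℝ) {u : Ω → κ → ℝ} (hu : ∀ i, MemLp (fun ω => u ω i) 2 μ) :
    Integrable (fun ω => qf X (u ω)) μ := by
  unfold qf
  refine integrable_finsetSum _ fun i _ => integrable_finsetSum _ fun j _ => ?_
  have := ((hu i).integrable_mul (hu j)).const_mul (X (i, j))
  refine this.congr (ae_of_all _ fun ω => ?_)
  simp only [Pi.mul_apply]
  ring

theorem integral_qf (X : κ × κ → ℝ) {u : Ω → κ → ℝ} (hu : ∀ i, MemLp (fun ω => u ω i) 2 μ) :
    ∫ ω, qf X (u ω) ∂μ = ∑ i, ∑ j, X (i, j) * ∫ ω, u ω i * u ω j ∂μ := by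
  unfold qf
  have hint : ∀ i j, Integrable (fun ω => u ω i * X (i, j) * u ω j) μ := fun i j => by
    have := ((hu i).integrable_mul (hu j)).const_mul (X (i, j))
    refine this.congr (ae_of_all _ fun ω => ?_)
    simp only [Pi.mul_apply]
    ring
  rw [integral_finsetSum _ fun i _ => integrable_finsetSum _ fun j _ => hint i j]
  refine Finset.sum_congr rfl fun i _ => ?_
  rw [integral_finsetSum _ fun j _ => hint i j]
  refine Finset.sum_congr rfl fun j _ => ?_
  rw [← integral_const_mul]
  exact integral_congr_ae (ae_of_all _ fun ω => by ring)

omit [Fintype κ] in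
theorem L2Mat.mulVec {B : Ω → Matrix κ ι ℝ} (hB : L2Mat μ B) (v : ι → ℝ) (i : κ) :
    MemLp (fun ω => (B ω).mulVec v i) 2 μ := by
  simp only [Matrix.mulVec, dotProduct]
  exact memLp_finsetSum _ fun j _ => (hB i j).mul_const _

omit [Fintype κ] [Fintype ι] in
theorem L2Mat.transpose {B : Ω → Matrix κ ι ℝ} (hB : L2Mat μ B) :
    L2Mat μ fun ω => (B ω).transpose := fun i j => hB j i

omit [Fintype κ] in
theorem integral_mulVec_mul_mulVec {B : Ω → Matrix κ ι ℝ} (hB : L2Mat μ B) (v : ι → ℝ) (i j : κ) :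
    ∫ ω, (B ω).mulVec v i * (B ω).mulVec v j ∂μ
      = ∑ k, ∑ l, v k * v l * ∫ ω, B ω i k * B ω j l ∂μ := by
  simp only [Matrix.mulVec, dotProduct, Finset.sum_mul_sum]
  have hint : ∀ k l, Integrable (fun ω => B ω i k * v k * (B ω j l * v l)) μ := fun k l =>
    ((hB i k).mul_const _).integrable_mul ((hB j l).mul_const _)
  rw [integral_finsetSum _ fun k _ => integrable_finsetSum _ fun l _ => hint k l]
  refine Finset.sum_congr rfl fun k _ => ?_
  rw [integral_finsetSum _ fun l _ => hint k l]
  refine Finset.sum_congr rfl fun l _ => ?_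
  rw [← integral_const_mul]
  exact integral_congr_ae (ae_of_all _ fun ω => by ring)

/-- On forms, `mom` acts from the right as `y ↦ E[Bᵀ y B]` and, by transposition, from the left as
`y ↦ E[B y Bᵀ]`. Both actions therefore preserve nonnegative forms. -/
theorem qf_vecMul_mom {B : Ω → Matrix κ ι ℝ} (hB : L2Mat μ B) (y : κ × κ → ℝ) (v : ι → ℝ) :
    qf (Matrix.vecMul y (mom μ B)) v = ∫ ω, qf y ((B ω).mulVec v) ∂μ := by
  rw [integral_qf y (hB.mulVec v)]
  simp only [integral_mulVec_mul_mulVec hB, qf, Matrix.vecMul, dotProduct, Fintype.sum_prod_type,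
    mom_apply, Finset.mul_sum, Finset.sum_mul]
  simp only [← Fintype.sum_prod_type']
  refine Fintype.sum_equiv ⟨fun z => ⟨z.2.2.1, z.2.2.2, z.1, z.2.1⟩,
    fun z => ⟨z.2.2.1, z.2.2.2, z.1, z.2.1⟩, fun _ => rfl, fun _ => rfl⟩ _ _ fun z => ?_
  simp only [Equiv.coe_fn_mk]
  ring

omit [Fintype κ] [Fintype ι] in
theorem mom_transpose (B : Ω → Matrix κ ι ℝ) :
    mom μ (fun ω => (B ω).transpose) = (mom μ B).transpose := rfl

theorem qf_mom_mulVec {B : Ω → Matrix κ ι ℝ} (hB : L2Mat μ B) (y : ι × ι → ℝ) (v : κ → ℝ) :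
    qf ((mom μ B).mulVec y) v = ∫ ω, qf y ((B ω).transpose.mulVec v) ∂μ := by
  rw [← qf_vecMul_mom hB.transpose, mom_transpose, Matrix.vecMul_transpose]

theorem qf_vecMul_mom_nonneg {B : Ω → Matrix κ ι ℝ} (hB : L2Mat μ B) {y : κ × κ → ℝ}
    (hy : ∀ v, 0 ≤ qf y v) (v : ι → ℝ) : 0 ≤ qf (Matrix.vecMul y (mom μ B)) v := by
  rw [qf_vecMul_mom hB]
  exact integral_nonneg fun ω => hy _

theorem qf_mom_mulVec_nonneg {B : Ω → Matrix κ ι ℝ} (hB : L2Mat μ B) {y : ι × ι → ℝ}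
    (hy : ∀ v, 0 ≤ qf y v) (v : κ → ℝ) : 0 ≤ qf ((mom μ B).mulVec y) v := by
  rw [qf_mom_mulVec hB]
  exact integral_nonneg fun ω => hy _

omit [Fintype ι] in
theorem vecMul_mom_symm (B : Ω → Matrix κ ι ℝ) {y : κ × κ → ℝ}
    (hy : ∀ i j, y (i, j) = y (j, i)) (i j : ι) :
    Matrix.vecMul y (mom μ B) (i, j) = Matrix.vecMul y (mom μ B) (j, i) := by
  simp only [Matrix.vecMul, dotProduct]
  refine Fintype.sum_equiv (Equiv.prodComm κ κ) _ _ fun x => ?_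
  obtain ⟨a, b⟩ := x
  rw [Equiv.prodComm_apply, Prod.swap_prod_mk, hy a b, mom_swap]

omit [Fintype κ] in
theorem mom_mulVec_symm (B : Ω → Matrix κ ι ℝ) {y : ι × ι → ℝ}
    (hy : ∀ i j, y (i, j) = y (j, i)) (i j : κ) :
    (mom μ B).mulVec y (i, j) = (mom μ B).mulVec y (j, i) := by
  have := vecMul_mom_symm (μ := μ) (fun ω => (B ω).transpose) hy i j
  rwa [mom_transpose, Matrix.vecMul_transpose] at this

omit [Fintype κ] [Fintype ι] in
/-- A diagonal moment dominates the mixed ones. -/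
theorem abs_mom_le {B : Ω → Matrix κ ι ℝ} (hB : L2Mat μ B) (i j : κ) (k l : ι) :
    |mom μ B (i, j) (k, l)| ≤ (mom μ B (i, i) (k, k) + mom μ B (j, j) (l, l)) / 2 := by
  simp only [mom_apply]
  have h1 : Integrable (fun ω => B ω i k * B ω i k) μ := (hB i k).integrable_mul (hB i k)
  have h2 : Integrable (fun ω => B ω j l * B ω j l) μ := (hB j l).integrable_mul (hB j l)
  have h3 : Integrable (fun ω => B ω i k * B ω j l) μ := (hB i k).integrable_mul (hB j l)
  rw [← integral_add h1 h2, ← integral_div]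
  refine (abs_integral_le_integral_abs).trans (integral_mono h3.abs ((h1.add h2).div_const _) ?_)
  intro ω
  simp only
  rw [abs_le]
  constructor <;> nlinarith [sq_nonneg (B ω i k - B ω j l), sq_nonneg (B ω i k + B ω j l)]

end Moments

end LPVMA

namespace LPVMA

/-! ### White scheduling vectors and the second-moment dynamics -/

/-- A random vector with orthogonal coordinates of positive second moments `σ` and with square
integrable products of coordinates. -/
structure IsWhite {Ω A : Type*} [MeasurableSpace Ω] [DecidableEq A] (μ : Measure Ω) (w : Ω → A → ℝ)
    (σ : A → ℝ) : Prop where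
  memLp : ∀ x, MemLp (fun ω => w ω x) 2 μ
  memLp_mul : ∀ x y, MemLp (fun ω => w ω x * w ω y) 2 μ
  integral_mul : ∀ x y, ∫ ω, w ω x * w ω y ∂μ = if x = y then σ x else 0
  pos : ∀ x, 0 < σ x

theorem lin_mulVec_eq_sum {A κ ι : Type*} [Fintype A] [Fintype ι] (B : A → Matrix κ ι ℝ)
    (w : A → ℝ) (u : ι → ℝ) :
    (lin B w).mulVec u = ∑ z : A × ι, (w z.1 * u z.2) • fun i => B z.1 i z.2 := by
  rw [lin_mulVec]
  funext i
  simp only [Finset.sum_apply, Pi.smul_apply, smul_eq_mul, Fintype.sum_prod_type,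
    Matrix.mulVec, dotProduct, Finset.mul_sum]
  exact Finset.sum_congr rfl fun x _ => Finset.sum_congr rfl fun a _ => by ring

namespace IsWhite

variable {Ω A κ ι ν : Type*} [MeasurableSpace Ω] [Fintype A] [DecidableEq A] {μ : Measure Ω}
  {w : Ω → A → ℝ} {σ : A → ℝ}

theorem l2Mat_lin (hw : IsWhite μ w σ) (B : A → Matrix κ ι ℝ) :
    L2Mat μ fun ω => lin B (w ω) := fun i j => by
  simp only [lin_apply]
  exact memLp_finsetSum _ fun x _ => (hw.memLp x).mul_const _

/-- Both factors depend on the same scheduling vector, so the product is quadratic in it; this is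
why `IsWhite` contains `memLp_mul`. -/
theorem l2Mat_lin_mul_lin [Fintype ι] (hw : IsWhite μ w σ) (B : A → Matrix κ ι ℝ)
    (B' : A → Matrix ι ν ℝ) : L2Mat μ fun ω => lin B (w ω) * lin B' (w ω) := fun i j => by
  simp only [Matrix.mul_apply, lin_apply, Finset.sum_mul_sum]
  refine memLp_finsetSum _ fun k _ => memLp_finsetSum _ fun x _ => memLp_finsetSum _ fun y _ => ?_
  have := (hw.memLp_mul x y).mul_const (B x i k * B' y k j)
  refine this.congr_norm ?_ (ae_of_all _ fun ω => ?_)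
  · have h1 := ((hw.memLp x).aestronglyMeasurable.mul_const (B x i k))
    have h2 := ((hw.memLp y).aestronglyMeasurable.mul_const (B' y k j))
    exact h1.mul h2
  · congr 1
    ring

/-- Orthogonality removes the cross terms. For a nonnegative `Z` a vanishing expectation then makes
the term of each character vanish separately. -/
theorem integral_qf_lin [Fintype κ] (hw : IsWhite μ w σ) (Z : κ × κ → ℝ) (u : A → κ → ℝ) :
    ∫ ω, qf Z (∑ x, w ω x • u x) ∂μ = ∑ x, σ x * qf Z (u x) := by
  have hu : ∀ i, MemLp (fun ω => (∑ x, w ω x • u x) i) 2 μ := fun i => by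
    simp only [Finset.sum_apply, Pi.smul_apply, smul_eq_mul]
    exact memLp_finsetSum _ fun x _ => (hw.memLp x).mul_const _
  rw [integral_qf Z hu]
  have h : ∀ i j, ∫ ω, (∑ x, w ω x • u x) i * (∑ x, w ω x • u x) j ∂μ
      = ∑ x, σ x * (u x i * u x j) := fun i j => by
    have := integral_mulVec_mul_mulVec (μ := μ)
      (B := fun ω => (Matrix.of fun i x => w ω x * u x i : Matrix κ A ℝ))
      (fun i x => (hw.memLp x).mul_const _) (fun _ => 1) i j
    simp only [Matrix.mulVec, dotProduct, Matrix.of_apply, mul_one] at this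
    simp only [Finset.sum_apply, Pi.smul_apply, smul_eq_mul, this, one_mul]
    refine Finset.sum_congr rfl fun x _ => ?_
    rw [Finset.sum_eq_single x]
    · rw [show (fun ω => w ω x * u x i * (w ω x * u x j))
        = fun ω => (w ω x * w ω x) * (u x i * u x j) from funext fun ω => by ring,
        integral_mul_const, hw.integral_mul, if_pos rfl]
    · intro y _ hy
      rw [show (fun ω => w ω x * u x i * (w ω y * u y j))
        = fun ω => (w ω x * w ω y) * (u x i * u y j) from funext fun ω => by ring,
        integral_mul_const, hw.integral_mul, if_neg (Ne.symm hy), zero_mul]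
    · simp
  simp only [h, qf, Finset.mul_sum]
  rw [Finset.sum_comm' (t' := Finset.univ) (s' := fun _ => Finset.univ) (by simp)]
  conv_rhs => rw [Finset.sum_comm]
  rw [Finset.sum_comm]
  refine Finset.sum_congr rfl fun i _ => ?_
  rw [Finset.sum_comm]
  exact Finset.sum_congr rfl fun j _ => Finset.sum_congr rfl fun x _ => by ring

end IsWhite

/-! ### Observability and stability of the second-moment dynamics -/

section Dynamics

variable {Ω : Type*} [MeasurableSpace Ω] {np ny n : ℕ} {μ : Measure Ω}
  {w : Ω → Fin (np + 1) → ℝ} {σ : Fin (np + 1) → ℝ}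

theorem l2Mat_errMat (hw : IsWhite μ w σ) (θ : Param np ny n) :
    L2Mat μ fun ω => errMat θ (w ω) := fun i j =>
  (hw.l2Mat_lin (shiftMat ny n) i j).sub (hw.l2Mat_lin_mul_lin (gainMat θ) (outMat ny n) i j)

/-- The second-moment transition matrix of the predictor error. -/
noncomputable def trans (μ : Measure Ω) (w : Ω → Fin (np + 1) → ℝ) (θ : Param np ny n) :
    Matrix (StateIdx np ny n × StateIdx np ny n) (StateIdx np ny n × StateIdx np ny n) ℝ :=
  mom μ fun ω => errMat θ (w ω)

/-- The second moment of the output matrix. -/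
noncomputable def outMom (ny n : ℕ) (μ : Measure Ω) (w : Ω → Fin (np + 1) → ℝ) :
    Matrix (Fin ny × Fin ny) (StateIdx np ny n × StateIdx np ny n) ℝ :=
  mom μ fun ω => lin (outMat ny n) (w ω)

/-- The second moment of the gain. -/
noncomputable def gainMom (μ : Measure Ω) (w : Ω → Fin (np + 1) → ℝ) (θ : Param np ny n) :
    Matrix (StateIdx np ny n × StateIdx np ny n) (Fin ny × Fin ny) ℝ :=
  mom μ fun ω => lin (gainMat θ) (w ω)

/-- The form `v ↦ E‖c M ⋯ M v‖²`, with `k` factors `M`. -/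
noncomputable def costate (μ : Measure Ω) (w : Ω → Fin (np + 1) → ℝ) (θ : Param np ny n) (k : ℕ) :
    StateIdx np ny n × StateIdx np ny n → ℝ :=
  Matrix.vecMul (vecOne (Fin ny)) (outMom ny n μ w * trans μ w θ ^ k)

theorem costate_succ (θ : Param np ny n) (k : ℕ) :
    costate μ w θ (k + 1) = Matrix.vecMul (costate μ w θ k) (trans μ w θ) := by
  simp only [costate, Matrix.vecMul_vecMul, pow_succ, Matrix.mul_assoc]

theorem costate_zero (θ : Param np ny n) :
    costate μ w θ 0 = Matrix.vecMul (vecOne (Fin ny)) (outMom ny n μ w) := by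
  simp [costate]

theorem qf_vecOne_nonneg {κ : Type*} [Fintype κ] [DecidableEq κ] (v : κ → ℝ) :
    0 ≤ qf (vecOne κ) v := by
  rw [qf_vecOne]
  positivity

theorem qf_costate_nonneg (hw : IsWhite μ w σ) (θ : Param np ny n) (k : ℕ)
    (v : StateIdx np ny n → ℝ) : 0 ≤ qf (costate μ w θ k) v := by
  induction k generalizing v with
  | zero =>
    rw [costate_zero]
    exact qf_vecMul_mom_nonneg (hw.l2Mat_lin _) qf_vecOne_nonneg v
  | succ k ih =>
    rw [costate_succ]
    exact qf_vecMul_mom_nonneg (l2Mat_errMat hw θ) ih v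

theorem costate_symm (θ : Param np ny n) (k : ℕ) (i j : StateIdx np ny n) :
    costate μ w θ k (i, j) = costate μ w θ k (j, i) := by
  induction k generalizing i j with
  | zero =>
    rw [costate_zero]
    exact vecMul_mom_symm _ (fun a b => by simp [vecOne, eq_comm]) i j
  | succ k ih =>
    rw [costate_succ]
    exact vecMul_mom_symm _ ih i j

theorem qf_costate_zero (hw : IsWhite μ w σ) (θ : Param np ny n) (v : StateIdx np ny n → ℝ) :
    qf (costate μ w θ 0) v = ∑ x, σ x * qf (vecOne (Fin ny)) ((outMat ny n x).mulVec v) := by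
  rw [costate_zero, outMom, qf_vecMul_mom (hw.l2Mat_lin _)]
  simp only [lin_mulVec]
  exact hw.integral_qf_lin _ _

theorem qf_costate_succ (hw : IsWhite μ w σ) (θ : Param np ny n) (k : ℕ)
    (v : StateIdx np ny n → ℝ) : qf (costate μ w θ (k + 1)) v
      = ∫ ω, qf (costate μ w θ k) ((errMat θ (w ω)).mulVec v) ∂μ := by
  rw [costate_succ, trans, qf_vecMul_mom (l2Mat_errMat hw θ)]

/-- Observability of the predictor error. -/
theorem eq_zero_of_qf_costate (hw : IsWhite μ w σ) (θ : Param np ny n) (v : StateIdx np ny n → ℝ)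
    (hv : ∀ k, qf (costate μ w θ k) v = 0) : v = 0 := by
  refine eq_zero_of_unobservable (fun v => ∀ k, qf (costate μ w θ k) v = 0) (fun v hv => ?_) v hv
  have hc : ∀ x, (outMat ny n x).mulVec v = 0 := by
    have h0 := hv 0
    rw [qf_costate_zero hw, Finset.sum_eq_zero_iff_of_nonneg
      fun x _ => mul_nonneg (hw.pos x).le (qf_vecOne_nonneg _)] at h0
    intro x
    have h1 := (mul_eq_zero.mp (h0 x (Finset.mem_univ _))).resolve_left (hw.pos x).ne'
    rw [qf_vecOne, Finset.sum_eq_zero_iff_of_nonneg fun i _ => sq_nonneg _] at h1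
    exact funext fun a => pow_eq_zero_iff two_ne_zero |>.mp (h1 a (Finset.mem_univ _))
  refine ⟨hc, fun x k => ?_⟩
  have h0 := hv (k + 1)
  -- As `c v = 0`, the feedback `K c` is inactive and `M v = A v`; whiteness then separates the
  -- shifts of the different characters.
  have hM : ∀ ω, (errMat θ (w ω)).mulVec v = ∑ x, w ω x • (shiftMat ny n x).mulVec v := fun ω => by
    rw [errMat, Matrix.sub_mulVec, ← Matrix.mulVec_mulVec, lin_mulVec (outMat ny n),
      lin_mulVec (shiftMat ny n)]
    simp [hc]
  rw [qf_costate_succ hw] at h0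
  simp only [hM] at h0
  rw [hw.integral_qf_lin, Finset.sum_eq_zero_iff_of_nonneg
    fun x _ => mul_nonneg (hw.pos x).le (qf_costate_nonneg hw θ k _)] at h0
  exact (mul_eq_zero.mp (h0 x (Finset.mem_univ _))).resolve_left (hw.pos x).ne'

/-- A sum of nonnegative forms vanishes at `v` only if every summand does, and observability
excludes this for `v ≠ 0`. -/
theorem exists_pos_mul_le_qf_of_hasSum_costate (hw : IsWhite μ w σ) (θ : Param np ny n)
    {Y : StateIdx np ny n × StateIdx np ny n → ℝ} (hY : HasSum (costate μ w θ) Y) :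
    (∃ c : ℝ, 0 < c ∧ ∀ v, c * ∑ i, v i ^ 2 ≤ qf Y v) ∧ ∀ v, qf Y v = 0 → v = 0 := by
  have h0 : ∀ v, qf Y v = 0 → v = 0 := fun v hv => by
    refine eq_zero_of_qf_costate hw θ v fun k => ?_
    have h1 := hasSum_qf hY v
    rw [hv, hasSum_zero_iff_of_nonneg fun k => qf_costate_nonneg hw θ k v] at h1
    exact congrFun h1 k
  exact ⟨exists_pos_mul_le_qf (fun v => (hasSum_qf hY v).nonneg
    fun k => qf_costate_nonneg hw θ k v) h0, h0⟩

/-- Summability of the output energy from the gain directions propagates to all states. -/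
theorem summable_qf_costate (hw : IsWhite μ w σ) (θ : Param np ny n)
    (hsum : ∀ x a, Summable fun k => qf (costate μ w θ k) fun i => gainMat θ x i a)
    (v : StateIdx np ny n → ℝ) : Summable fun k => qf (costate μ w θ k) v := by
  -- In `M v = A v - K c v` the first part is a combination of shifts of `v`, covered by the
  -- induction, and the second a random combination of gain columns, covered by `hsum`.
  refine shiftMat_induction (fun v => Summable fun k => qf (costate μ w θ k) v)
    (by simp only [qf_zero_right]; exact summable_zero) (fun v hv => ?_) v
  rw [← summable_nat_add_iff 1]
  obtain ⟨β, hβ_def⟩ : ∃ β : Ω → Fin (np + 1) × Fin ny → ℝ,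
    ∀ ω z, β ω z = w ω z.1 * (lin (outMat ny n) (w ω)).mulVec v z.2 := ⟨_, fun _ _ => rfl⟩
  obtain ⟨r, hr⟩ : ∃ r : Fin (np + 1) × Fin ny → StateIdx np ny n → ℝ,
    ∀ z, r z = fun i => gainMat θ z.1 i z.2 := ⟨_, fun _ => rfl⟩
  have hβ : ∀ z, MemLp (fun ω => β ω z) 2 μ := fun z => by
    have h1 : ∀ ω, β ω z = ∑ y, (w ω z.1 * w ω y) * (outMat ny n y).mulVec v z.2 := fun ω => by
      simp only [hβ_def, lin_mulVec, Finset.sum_apply, Pi.smul_apply, smul_eq_mul,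
        Finset.mul_sum, mul_assoc]
    simp only [h1]
    exact memLp_finsetSum _ fun y _ => (hw.memLp_mul z.1 y).mul_const _
  have hM : ∀ ω, (errMat θ (w ω)).mulVec v
      = (∑ x, w ω x • (shiftMat ny n x).mulVec v) - ∑ z, β ω z • r z := fun ω => by
    rw [errMat, Matrix.sub_mulVec, ← Matrix.mulVec_mulVec, lin_mulVec (shiftMat ny n),
      lin_mulVec_eq_sum (gainMat θ)]
    simp only [hβ_def, hr]
  -- The constant has to be uniform in the form, because the estimate is summed over the costates.
  obtain ⟨C, hC⟩ : ∃ C : ℝ, ∀ X : StateIdx np ny n × StateIdx np ny n → ℝ, (∀ v, 0 ≤ qf X v) →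
      ∀ r : Fin (np + 1) × Fin ny → StateIdx np ny n → ℝ,
        qf X (∑ z, r z) ≤ C * ∑ z, qf X (r z) := ⟨_, fun X hX r => qf_sum_le hX _ r⟩
  have hbound : ∀ k, qf (costate μ w θ (k + 1)) v
      ≤ 2 * ∑ x, σ x * qf (costate μ w θ k) ((shiftMat ny n x).mulVec v)
        + 2 * (C * ∑ z, (∫ ω, β ω z ^ 2 ∂μ) * qf (costate μ w θ k) (r z)) := by
    intro k
    have hnn := qf_costate_nonneg hw θ k
    rw [qf_costate_succ hw, ← hw.integral_qf_lin]
    generalize costate μ w θ k = X at hnn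
    have hi1 : Integrable (fun ω => qf X (∑ x, w ω x • (shiftMat ny n x).mulVec v)) μ := by
      refine integrable_qf _ fun i => ?_
      simp only [Finset.sum_apply, Pi.smul_apply, smul_eq_mul]
      exact memLp_finsetSum _ fun x _ => (hw.memLp x).mul_const _
    have hi2 : ∀ z, Integrable (fun ω => β ω z ^ 2 * qf X (r z)) μ := fun z =>
      (hβ z).integrable_sq.mul_const _
    have hi3 : Integrable (fun ω => ∑ z, β ω z ^ 2 * qf X (r z)) μ :=
      integrable_finsetSum _ fun z _ => hi2 z
    have he : ∫ ω, ∑ z, β ω z ^ 2 * qf X (r z) ∂μ = ∑ z, (∫ ω, β ω z ^ 2 ∂μ) * qf X (r z) := by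
      rw [integral_finsetSum _ fun z _ => hi2 z]
      exact Finset.sum_congr rfl fun z _ => integral_mul_const _ _
    rw [← he, ← integral_const_mul, ← integral_const_mul, ← integral_const_mul,
      ← integral_add (hi1.const_mul 2) ((hi3.const_mul C).const_mul 2)]
    refine integral_mono (integrable_qf _ ((l2Mat_errMat hw θ).mulVec v))
      ((hi1.const_mul 2).add ((hi3.const_mul C).const_mul 2)) fun ω => ?_
    simp only [hM]
    refine (qf_sub_le hnn _ _).trans ?_
    have := hC X hnn fun z => β ω z • r z
    simp only [qf_smul_right] at this
    linarith
  refine Summable.of_nonneg_of_le (fun k => qf_costate_nonneg hw θ (k + 1) v) hbound ?_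
  exact ((summable_sum fun x _ => (hv x).mul_left _).mul_left _).add
    (((summable_sum fun z _ => (hr z ▸ hsum z.1 z.2 :
      Summable fun k => qf (costate μ w θ k) (r z)).mul_left _).mul_left _).mul_left _)

/-- Stability of the second-moment dynamics of the predictor error: the powers of the transition
matrix tend to zero if the second moments of the inverse filter are summable. -/
theorem tendsto_trans_pow (hw : IsWhite μ w σ) (θ : Param np ny n)
    (hpow : ∀ k, ∃ W : Ω → Matrix (StateIdx np ny n) (StateIdx np ny n) ℝ,
      L2Mat μ W ∧ mom μ W = trans μ w θ ^ k)
    (hsum : Summable fun k => ∑ a,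
      ((outMom ny n μ w * trans μ w θ ^ k * gainMom μ w θ).mulVec (vecOne (Fin ny))) (a, a))
    (x y : StateIdx np ny n × StateIdx np ny n) :
    Tendsto (fun k => (trans μ w θ ^ k) x y) atTop (𝓝 0) := by
  -- The hypothesis sums the energies of all gain columns with positive weights `σ x`; the terms are
  -- nonnegative, so each column has finite energy.
  have hgain : ∀ x a, Summable fun k => qf (costate μ w θ k) fun i => gainMat θ x i a := by
    have h1 : ∀ k, ∑ a,
        ((outMom ny n μ w * trans μ w θ ^ k * gainMom μ w θ).mulVec (vecOne (Fin ny))) (a, a)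
        = ∑ a, ∑ x, σ x * qf (costate μ w θ k) fun i => gainMat θ x i a := by
      intro k
      have h2 : ∑ a,
          ((outMom ny n μ w * trans μ w θ ^ k * gainMom μ w θ).mulVec (vecOne (Fin ny))) (a, a)
          = ∑ a, Matrix.vecMul (costate μ w θ k) (gainMom μ w θ) (a, a) := by
        have h3 : ∀ f : Fin ny × Fin ny → ℝ, ∑ a, f (a, a) = dotProduct (vecOne (Fin ny)) f := by
          intro f
          simp [dotProduct, vecOne, Fintype.sum_prod_type]
        rw [h3, h3, Matrix.dotProduct_mulVec, dotProduct_comm, costate, Matrix.vecMul_vecMul]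
      rw [h2]
      refine Finset.sum_congr rfl fun a _ => ?_
      rw [← qf_single (Matrix.vecMul (costate μ w θ k) (gainMom μ w θ)) a, gainMom, qf_vecMul_mom (hw.l2Mat_lin _)]
      simp only [lin_mulVec]
      rw [hw.integral_qf_lin]
      simp only [Matrix.mulVec_single_one]
      rfl
    simp only [h1] at hsum
    intro x a
    have h2 : Summable fun k => σ x * qf (costate μ w θ k) fun i => gainMat θ x i a := by
      have hnn : ∀ k a x, 0 ≤ σ x * qf (costate μ w θ k) fun i => gainMat θ x i a :=
        fun k a x => mul_nonneg (hw.pos x).le (qf_costate_nonneg hw θ k _)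
      refine Summable.of_nonneg_of_le (fun k => hnn k a x) (fun k => ?_) hsum
      exact (Finset.single_le_sum (f := fun x => σ x * qf (costate μ w θ k)
        fun i => gainMat θ x i a) (fun x _ => hnn k a x) (Finset.mem_univ x)).trans
        (Finset.single_le_sum (f := fun a => ∑ x, σ x * qf (costate μ w θ k)
          fun i => gainMat θ x i a) (fun a _ => Finset.sum_nonneg fun x _ => hnn k a x)
          (Finset.mem_univ a))
    exact (summable_mul_left_iff (hw.pos x).ne').mp h2
  have hall := summable_qf_costate hw θ hgain
  have hs : Summable (costate μ w θ) := summable_of_summable_qf (costate_symm θ) hall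
  obtain ⟨⟨c, hc, hcY⟩, -⟩ := exists_pos_mul_le_qf_of_hasSum_costate hw θ hs.hasSum
  set Y := ∑' k, costate μ w θ k with hY
  -- Applying `T^k` to `Y` from the right leaves the tail of the series of costates from `k` on.
  have hYk : ∀ k v, qf (Matrix.vecMul Y (trans μ w θ ^ k)) v
      = ∑' m, qf (costate μ w θ (m + k)) v := by
    intro k v
    have h1 : HasSum (fun m => costate μ w θ (m + k)) (Matrix.vecMul Y (trans μ w θ ^ k)) := by
      have h2 : ∀ m, costate μ w θ (m + k)
          = Matrix.vecMul (costate μ w θ m) (trans μ w θ ^ k) := fun m => by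
        simp only [costate, Matrix.vecMul_vecMul, pow_add, Matrix.mul_assoc]
      simp only [h2]
      refine Pi.hasSum.mpr fun z => ?_
      simp only [Matrix.vecMul, dotProduct]
      exact hasSum_sum fun u _ => (Pi.hasSum.mp hs.hasSum u).mul_right _
    exact (hasSum_qf h1 v).tsum_eq.symm
  have htail : ∀ v, Tendsto (fun k => qf (Matrix.vecMul Y (trans μ w θ ^ k)) v) atTop (𝓝 0) := by
    intro v
    simp only [hYk]
    exact tendsto_sum_nat_add fun k => qf (costate μ w θ k) v
  -- Since `T^m = E[W ⊗ W]`, this entry is `E[W_{ik}²]`, and `c` times it is at most `E` of the form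
  -- `Y` at the `k`-th column of `W`, a tail that tends to zero.
  have hdiag : ∀ i k, Tendsto (fun m => (trans μ w θ ^ m) (i, i) (k, k)) atTop (𝓝 0) := by
    intro i k
    have hlim := (htail (Pi.single k 1)).const_mul c⁻¹
    rw [mul_zero] at hlim
    refine squeeze_zero (fun m => ?_) (fun m => ?_) hlim
    · obtain ⟨W, -, hW⟩ := hpow m
      rw [← hW, mom_apply]
      exact integral_nonneg fun ω => mul_self_nonneg _
    · obtain ⟨W, hW2, hW⟩ := hpow m
      rw [← hW, inv_mul_eq_div, le_div_iff₀ hc, qf_vecMul_mom hW2]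
      have h1 : mom μ W (i, i) (k, k) * c = ∫ ω, W ω i k * W ω i k * c ∂μ := by
        rw [mom_apply, integral_mul_const]
      rw [h1]
      refine integral_mono (((hW2 i k).integrable_mul (hW2 i k)).mul_const c)
        (integrable_qf _ (hW2.mulVec _)) fun ω => ?_
      refine le_trans ?_ (hcY _)
      rw [mul_comm]
      refine mul_le_mul_of_nonneg_left ?_ hc.le
      have h2 := Finset.single_le_sum (f := fun i => ((W ω).mulVec (Pi.single k 1)) i ^ 2)
        (fun i _ => sq_nonneg _) (Finset.mem_univ i)
      simpa [sq] using h2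
  obtain ⟨i, j⟩ := x
  obtain ⟨k, l⟩ := y
  have hlim := ((hdiag i k).add (hdiag j l)).div_const 2
  rw [add_zero, zero_div] at hlim
  refine squeeze_zero_norm (fun m => ?_) hlim
  obtain ⟨W, hW2, hW⟩ := hpow m
  rw [← hW]
  exact abs_mom_le hW2 i j k l

end Dynamics

end LPVMA

namespace LPVMA

/-! ### Matrices whose powers tend to zero -/

section StableMatrix

/-- Division of the exponent by `m` bounds the powers by those of a number `a < 1`, and `r` is its
`m`-th root. -/
theorem exists_norm_pow_le {R : Type*} [NormedRing R] {T : R} {m : ℕ} (hm : m ≠ 0)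
    (hT : ‖T ^ m‖ < 1) : ∃ C r : ℝ, 0 ≤ C ∧ 0 ≤ r ∧ r < 1 ∧ ∀ k, ‖T ^ k‖ ≤ C * r ^ k := by
  -- The maximum with `1 / 2` keeps `a` positive when `T ^ m = 0`, as the constant `B / a` requires.
  obtain ⟨a, ha1, ha0, haT⟩ : ∃ a : ℝ, a < 1 ∧ 0 < a ∧ ‖T ^ m‖ ≤ a :=
    ⟨max ‖T ^ m‖ (1 / 2), max_lt hT (by norm_num), lt_max_of_lt_right (by norm_num),
      le_max_left _ _⟩
  set r : ℝ := a ^ (1 / (m : ℝ)) with hr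
  have hm0 : (0 : ℝ) < m := by exact_mod_cast Nat.pos_of_ne_zero hm
  have hr0 : 0 < r := Real.rpow_pos_of_pos ha0 _
  have hr1 : r < 1 := Real.rpow_lt_one ha0.le ha1 (by positivity)
  have hrm : r ^ m = a := by
    rw [hr, ← Real.rpow_natCast, ← Real.rpow_mul ha0.le, one_div_mul_cancel hm0.ne', Real.rpow_one]
  set B : ℝ := ∑ s ∈ Finset.range m, ‖T ^ s‖ + ‖(1 : R)‖ with hB
  have hB0 : 0 ≤ B := by positivity
  refine ⟨B / a, r, by positivity, hr0.le, hr1, fun k => ?_⟩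
  have hs : k % m < m := Nat.mod_lt _ (Nat.pos_of_ne_zero hm)
  have hpow : ∀ q s : ℕ, s < m → ‖T ^ (m * q + s)‖ ≤ a ^ q * B := by
    intro q s hs
    induction q with
    | zero =>
      simp only [mul_zero, zero_add, pow_zero, one_mul]
      have := Finset.single_le_sum (f := fun s => ‖T ^ s‖) (fun i _ => norm_nonneg _)
        (Finset.mem_range.mpr hs)
      have h1 := norm_nonneg (1 : R)
      linarith
    | succ q ih =>
      have h1 : m * (q + 1) + s = m + (m * q + s) := by ring
      rw [h1, pow_add, pow_succ' a, mul_assoc]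
      exact (norm_mul_le _ _).trans (mul_le_mul haT ih (norm_nonneg _) ha0.le)
  have hk := hpow (k / m) (k % m) hs
  rw [Nat.div_add_mod] at hk
  refine hk.trans ?_
  -- The extra factor `a` pays for rounding down: `k ≤ m (k / m + 1)`.
  have h2 : a * a ^ (k / m) ≤ r ^ k := by
    rw [← pow_succ', ← hrm, ← pow_mul]
    refine pow_le_pow_of_le_one hr0.le hr1.le ?_
    have := Nat.div_add_mod k m
    nlinarith
  rw [div_mul_eq_mul_div, le_div_iff₀ ha0]
  nlinarith

variable {ι : Type*} [Fintype ι] [DecidableEq ι]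

/-- The powers of the matrix tend to zero. -/
def StableMat (T : Matrix ι ι ℝ) : Prop := Tendsto (fun k => T ^ k) atTop (𝓝 0)

attribute [local instance] Matrix.linftyOpNormedRing

theorem StableMat.exists_norm_lt {T : Matrix ι ι ℝ} (hT : StableMat T) :
    ∃ m : ℕ, m ≠ 0 ∧ ‖T ^ m‖ < 1 := by
  have h1 := (tendsto_norm_zero.comp hT).eventually_lt_const one_pos
  obtain ⟨m, hm, hm0⟩ := (h1.and (eventually_ne_atTop 0)).exists
  exact ⟨m, hm0, hm⟩

theorem stableMat_of_norm_lt {T : Matrix ι ι ℝ} {m : ℕ} (hm : m ≠ 0) (hT : ‖T ^ m‖ < 1) :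
    StableMat T := by
  obtain ⟨C, r, hC, hr0, hr1, h⟩ := exists_norm_pow_le hm hT
  refine squeeze_zero_norm h ?_
  simpa using (tendsto_pow_atTop_nhds_zero_of_lt_one hr0 hr1).const_mul C

/-- Stability is witnessed by a single power of norm less than one, and each such condition is open.
-/
theorem isOpen_stableMat : IsOpen {T : Matrix ι ι ℝ | StableMat T} := by
  have : {T : Matrix ι ι ℝ | StableMat T} = ⋃ m : {m : ℕ // m ≠ 0}, {T | ‖T ^ m.1‖ < 1} := by
    ext T
    simp only [Set.mem_ofPred_eq, Set.mem_iUnion]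
    exact ⟨fun h => let ⟨m, hm, h⟩ := h.exists_norm_lt; ⟨⟨m, hm⟩, h⟩,
      fun ⟨m, h⟩ => stableMat_of_norm_lt m.2 h⟩
  rw [this]
  exact isOpen_iUnion fun m => isOpen_lt ((continuous_pow m.1).norm) continuous_const

theorem abs_apply_le_linfty_opNorm (T : Matrix ι ι ℝ) (x y : ι) : |T x y| ≤ ‖T‖ := by
  have h1 : ‖T x y‖₊ ≤ ‖T‖₊ := by
    rw [Matrix.linfty_opNNNorm_def]
    exact (Finset.single_le_sum (f := fun y => ‖T x y‖₊) (fun _ _ => zero_le)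
      (Finset.mem_univ y)).trans
      (Finset.le_sup (f := fun x => ∑ y, ‖T x y‖₊) (Finset.mem_univ x))
  exact_mod_cast h1

theorem StableMat.exists_abs_pow_le {T : Matrix ι ι ℝ} (hT : StableMat T) :
    ∃ C r : ℝ, 0 ≤ C ∧ 0 ≤ r ∧ r < 1 ∧ ∀ k x y, |(T ^ k) x y| ≤ C * r ^ k := by
  obtain ⟨m, hm, h⟩ := hT.exists_norm_lt
  obtain ⟨C, r, hC, hr0, hr1, h⟩ := exists_norm_pow_le hm h
  exact ⟨C, r, hC, hr0, hr1, fun k x y => (abs_apply_le_linfty_opNorm _ x y).trans (h k)⟩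

end StableMatrix

/-! ### The Neumann series and differentiability of the inverse -/

section Resolvent

variable {ι : Type*} [Fintype ι] [DecidableEq ι]

theorem StableMat.summable_pow {T : Matrix ι ι ℝ} (hT : StableMat T) :
    Summable fun k => T ^ k := by
  obtain ⟨C, r, -, hr0, hr1, h⟩ := hT.exists_abs_pow_le
  refine Pi.summable.mpr fun x => Pi.summable.mpr fun y => ?_
  exact Summable.of_norm_bounded ((summable_geometric_of_lt_one hr0 hr1).mul_left C)
    fun k => h k x y

theorem StableMat.hasSum_pow {T : Matrix ι ι ℝ} (hT : StableMat T) :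
    HasSum (fun k => T ^ k) (1 - T)⁻¹ := by
  have h1 := hT.summable_pow
  have h2 := h1.tsum_pow_mul_one_sub
  rw [Matrix.inv_eq_left_inv h2]
  exact h1.hasSum

theorem StableMat.isUnit_det {T : Matrix ι ι ℝ} (hT : StableMat T) : IsUnit (1 - T).det := by
  have h2 := hT.summable_pow.tsum_pow_mul_one_sub
  exact (Matrix.isUnit_iff_isUnit_det _).mp (IsUnit.of_mul_eq_one_right _ h2)

variable {E : Type*} [NormedAddCommGroup E] [NormedSpace ℝ E]

theorem differentiableAt_det {κ : Type*} [Fintype κ] [DecidableEq κ] {A : E → Matrix κ κ ℝ} {θ : E}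
    (hA : ∀ x y, DifferentiableAt ℝ (fun θ => A θ x y) θ) :
    DifferentiableAt ℝ (fun θ => (A θ).det) θ := by
  simp only [Matrix.det_apply']
  refine DifferentiableAt.fun_sum fun s _ => DifferentiableAt.const_mul ?_ _
  have h : ∀ t : Finset κ, DifferentiableAt ℝ (fun θ => ∏ i ∈ t, A θ (s i) i) θ := by
    intro t
    induction t using Finset.induction_on with
    | empty => simp
    | insert i t hi ih =>
      simp only [Finset.prod_insert hi]
      exact (hA _ _).mul ih
  exact h _

/-- By Cramer's rule the entries are quotients of determinants. -/
theorem differentiableAt_inv_apply {A : E → Matrix ι ι ℝ} {θ : E}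
    (hA : ∀ x y, DifferentiableAt ℝ (fun θ => A θ x y) θ) (hdet : IsUnit (A θ).det) (x y : ι) :
    DifferentiableAt ℝ (fun θ => (A θ)⁻¹ x y) θ := by
  simp only [Matrix.inv_def, Matrix.smul_apply, smul_eq_mul, Ring.inverse_eq_inv,
    Matrix.adjugate_apply]
  refine ((differentiableAt_det hA).inv hdet.ne_zero).mul (differentiableAt_det fun i j => ?_)
  by_cases h : i = y
  · subst h
    simp [Matrix.updateRow_self]
  · simpa [Matrix.updateRow_ne h] using hA i j

end Resolvent

end LPVMA

namespace LPVMA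

/-! ### The loss as a function of second moments -/

section Smooth

variable {Ω : Type*} [MeasurableSpace Ω] {μ : Measure Ω} {κ ι U : Type*} [Fintype U]

theorem mom_sum_smul {B : U → Ω → Matrix κ ι ℝ} (hB : ∀ u, L2Mat μ (B u)) (α : U → ℝ)
    (x : κ × κ) (y : ι × ι) : mom μ (fun ω => ∑ u, α u • B u ω) x y
      = ∑ u, ∑ v, α u * α v * mom₂ μ (B u) (B v) x y := by
  simp only [mom_apply, mom₂, Matrix.of_apply, Matrix.sum_apply, Matrix.smul_apply, smul_eq_mul,
    Finset.sum_mul_sum]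
  have hint : ∀ u v, Integrable
      (fun ω => α u * B u ω x.1 y.1 * (α v * B v ω x.2 y.2)) μ := fun u v =>
    ((hB u _ _).const_mul _).integrable_mul ((hB v _ _).const_mul _)
  rw [integral_finsetSum _ fun k _ => integrable_finsetSum _ fun l _ => hint k l]
  refine Finset.sum_congr rfl fun u _ => ?_
  rw [integral_finsetSum _ fun l _ => hint u l]
  refine Finset.sum_congr rfl fun v _ => ?_
  rw [← integral_const_mul]
  exact integral_congr_ae (ae_of_all _ fun ω => by ring)

/-- The second moment is a quadratic polynomial in the coefficients `α`. -/
theorem differentiable_mom {E : Type*} [NormedAddCommGroup E] [NormedSpace ℝ E]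
    {B : U → Ω → Matrix κ ι ℝ} (hB : ∀ u, L2Mat μ (B u)) {α : E → U → ℝ}
    (hα : ∀ u, Differentiable ℝ fun θ => α θ u) (x : κ × κ) (y : ι × ι) :
    Differentiable ℝ fun θ => mom μ (fun ω => ∑ u, α θ u • B u ω) x y := by
  simp only [mom_sum_smul hB]
  exact Differentiable.fun_sum fun u _ => Differentiable.fun_sum fun v _ =>
    ((hα u).mul (hα v)).mul_const _

end Smooth

section Loss

variable {Ω : Type*} [MeasurableSpace Ω] {np ny n : ℕ} {μ : Measure Ω}
  {w : Ω → Fin (np + 1) → ℝ} {σ : Fin (np + 1) → ℝ}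

theorem lin_gainMat_eq_sum (θ : Param np ny n) (w : Fin (np + 1) → ℝ) :
    lin (gainMat θ) w = ∑ y, θ y • lin (gainMat (Pi.single y 1)) w := by
  ext i b
  simp only [lin_apply, Matrix.sum_apply, Matrix.smul_apply, smul_eq_mul, Finset.mul_sum]
  rw [Finset.sum_comm]
  refine Finset.sum_congr rfl fun x _ => ?_
  simp only [gainMat, Matrix.of_apply, Pi.single_apply]
  simp [mul_comm]

theorem differentiable_trans (hw : IsWhite μ w σ) (x y) :
    Differentiable ℝ fun θ : Param np ny n => trans μ w θ x y := by
  -- The error transition is affine in `θ`; the index `none` with constant coefficient `1` carries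
  -- its `θ`-free part.
  let α : Param np ny n → Option (ParamIdx np ny n) → ℝ := fun θ u => u.elim 1 fun y => -θ y
  let B : Option (ParamIdx np ny n) → Ω → Matrix (StateIdx np ny n) (StateIdx np ny n) ℝ :=
    fun u ω => u.elim (lin (shiftMat ny n) (w ω))
      fun y => lin (gainMat (Pi.single y 1)) (w ω) * lin (outMat ny n) (w ω)
  have h : ∀ θ : Param np ny n, (fun ω => errMat θ (w ω)) = fun ω => ∑ u, α θ u • B u ω := by
    intro θ
    funext ω
    rw [errMat, lin_gainMat_eq_sum, Fintype.sum_option, Matrix.sum_mul]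
    simp [α, B, sub_eq_add_neg]
  simp only [trans, h]
  refine differentiable_mom (fun u => ?_) (fun u => ?_) x y
  · cases u with
    | none => exact hw.l2Mat_lin _
    | some y => exact hw.l2Mat_lin_mul_lin _ _
  · cases u with
    | none => exact differentiable_const _
    | some y => exact (differentiable_apply y).neg

theorem differentiable_gainMom_sub (hw : IsWhite μ w σ) (h : Param np ny n) (x y) :
    Differentiable ℝ fun θ : Param np ny n => gainMom μ w (h - θ) x y := by
  simp only [gainMom, lin_gainMat_eq_sum (h - _)]
  refine differentiable_mom (fun u => hw.l2Mat_lin _) (fun u => ?_) x y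
  simp only [Pi.sub_apply]
  exact (differentiable_const _).sub (differentiable_apply u)

/-- A covariance matrix as a function on pairs. -/
def vecMat (S : Matrix (Fin ny) (Fin ny) ℝ) : Fin ny × Fin ny → ℝ := fun x => S x.1 x.2

/-- The stationary second moment of the state error of the predictor. -/
noncomputable def errCov (μ : Measure Ω) (w : Ω → Fin (np + 1) → ℝ)
    (S : Matrix (Fin ny) (Fin ny) ℝ) (h θ : Param np ny n) :
    StateIdx np ny n × StateIdx np ny n → ℝ :=
  ((1 - trans μ w θ)⁻¹).mulVec ((gainMom μ w (h - θ)).mulVec (vecMat S))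

/-- The sum of the `costate` forms. -/
noncomputable def costateSum (μ : Measure Ω) (w : Ω → Fin (np + 1) → ℝ) (θ : Param np ny n) :
    StateIdx np ny n × StateIdx np ny n → ℝ :=
  Matrix.vecMul (Matrix.vecMul (vecOne (Fin ny)) (outMom ny n μ w)) (1 - trans μ w θ)⁻¹

/-- The asymptotic loss expressed through second moments. -/
noncomputable def momLoss (μ : Measure Ω) (w : Ω → Fin (np + 1) → ℝ)
    (S : Matrix (Fin ny) (Fin ny) ℝ) (h θ : Param np ny n) : ℝ :=
  S.trace + dotProduct (costateSum μ w θ) ((gainMom μ w (h - θ)).mulVec (vecMat S))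

theorem isOpen_stableMat_trans (hw : IsWhite μ w σ) :
    IsOpen {θ : Param np ny n | StableMat (trans μ w θ)} := by
  have h : Continuous fun θ : Param np ny n => trans μ w θ :=
    continuous_matrix fun x y => (differentiable_trans hw x y).continuous
  exact isOpen_stableMat.preimage h

theorem differentiableAt_costateSum (hw : IsWhite μ w σ) {θ : Param np ny n}
    (hθ : StableMat (trans μ w θ)) (x) :
    DifferentiableAt ℝ (fun θ => costateSum μ w θ x) θ := by
  simp only [costateSum, Matrix.vecMul, dotProduct]
  refine DifferentiableAt.fun_sum fun u _ => DifferentiableAt.const_mul ?_ _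
  exact differentiableAt_inv_apply (A := fun θ => 1 - trans μ w θ)
    (fun x y => (differentiable_trans hw x y θ).const_sub _) hθ.isUnit_det u x

theorem differentiableAt_momLoss (hw : IsWhite μ w σ) (S : Matrix (Fin ny) (Fin ny) ℝ)
    (h : Param np ny n) {θ : Param np ny n} (hθ : StableMat (trans μ w θ)) :
    DifferentiableAt ℝ (momLoss μ w S h) θ := by
  unfold momLoss
  refine (differentiableAt_const _).add ?_
  simp only [dotProduct]
  refine DifferentiableAt.fun_sum fun x _ => (differentiableAt_costateSum hw hθ x).mul ?_
  simp only [Matrix.mulVec, dotProduct]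
  exact DifferentiableAt.fun_sum fun y _ => ((differentiable_gainMom_sub hw h x y) θ).mul_const _

theorem qf_vecMat_nonneg {S : Matrix (Fin ny) (Fin ny) ℝ} (hS : S.PosSemidef) (v : Fin ny → ℝ) :
    0 ≤ qf (vecMat S) v := by
  have h := hS.dotProduct_mulVec_nonneg v
  simpa [qf, vecMat, dotProduct, Matrix.mulVec, Finset.mul_sum, mul_assoc] using h

theorem eq_zero_of_qf_vecMat {S : Matrix (Fin ny) (Fin ny) ℝ} (hS : S.PosDef) {v : Fin ny → ℝ}
    (hv : qf (vecMat S) v = 0) : v = 0 := by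
  by_contra hne
  have h := hS.dotProduct_mulVec_pos hne
  simp only [star_trivial, dotProduct, Matrix.mulVec, Finset.mul_sum] at h
  simp only [qf, vecMat, mul_assoc] at hv
  exact h.ne' hv

theorem hasSum_errCov (S : Matrix (Fin ny) (Fin ny) ℝ) (h : Param np ny n) {θ : Param np ny n}
    (hθ : StableMat (trans μ w θ)) :
    HasSum (fun k => (trans μ w θ ^ k).mulVec ((gainMom μ w (h - θ)).mulVec (vecMat S)))
      (errCov μ w S h θ) := by
  refine Pi.hasSum.mpr fun x => ?_
  simp only [errCov, Matrix.mulVec, dotProduct]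
  exact hasSum_sum fun y _ => (Pi.hasSum.mp (Pi.hasSum.mp hθ.hasSum_pow x) y).mul_right _

theorem hasSum_costate {θ : Param np ny n} (hθ : StableMat (trans μ w θ)) :
    HasSum (costate μ w θ) (costateSum μ w θ) := by
  refine Pi.hasSum.mpr fun x => ?_
  have h : ∀ k, costate μ w θ k x
      = ∑ y, Matrix.vecMul (vecOne (Fin ny)) (outMom ny n μ w) y * (trans μ w θ ^ k) y x :=
    fun k => by rw [costate, ← Matrix.vecMul_vecMul]; rfl
  simp only [h]
  exact hasSum_sum fun y _ => (Pi.hasSum.mp (Pi.hasSum.mp hθ.hasSum_pow y) x).mul_left _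

theorem qf_trans_pow_mulVec_nonneg (hw : IsWhite μ w σ) (θ : Param np ny n)
    {X : StateIdx np ny n × StateIdx np ny n → ℝ} (hX : ∀ v, 0 ≤ qf X v) (k : ℕ)
    (v : StateIdx np ny n → ℝ) : 0 ≤ qf ((trans μ w θ ^ k).mulVec X) v := by
  induction k generalizing v with
  | zero => simpa using hX v
  | succ k ih =>
    rw [pow_succ', ← Matrix.mulVec_mulVec]
    exact qf_mom_mulVec_nonneg (l2Mat_errMat hw θ) ih v

theorem trans_pow_mulVec_symm (θ : Param np ny n)
    {X : StateIdx np ny n × StateIdx np ny n → ℝ} (hX : ∀ i j, X (i, j) = X (j, i)) (k : ℕ)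
    (i j : StateIdx np ny n) :
    (trans μ w θ ^ k).mulVec X (i, j) = (trans μ w θ ^ k).mulVec X (j, i) := by
  induction k generalizing i j with
  | zero => simpa using hX i j
  | succ k ih =>
    rw [pow_succ', ← Matrix.mulVec_mulVec]
    exact mom_mulVec_symm _ ih i j

theorem qf_gainMom_mulVec_nonneg (hw : IsWhite μ w σ) {S : Matrix (Fin ny) (Fin ny) ℝ}
    (hS : S.PosSemidef) (θ : Param np ny n) (v : StateIdx np ny n → ℝ) :
    0 ≤ qf ((gainMom μ w θ).mulVec (vecMat S)) v :=
  qf_mom_mulVec_nonneg (hw.l2Mat_lin _) (qf_vecMat_nonneg hS) v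

theorem qf_errCov_nonneg (hw : IsWhite μ w σ) {S : Matrix (Fin ny) (Fin ny) ℝ}
    (hS : S.PosSemidef) (h : Param np ny n) {θ : Param np ny n} (hθ : StableMat (trans μ w θ))
    (v : StateIdx np ny n → ℝ) : 0 ≤ qf (errCov μ w S h θ) v :=
  (hasSum_qf (hasSum_errCov S h hθ) v).nonneg fun k =>
    qf_trans_pow_mulVec_nonneg hw θ (qf_gainMom_mulVec_nonneg hw hS _) k v

theorem errCov_symm {S : Matrix (Fin ny) (Fin ny) ℝ} (hS : S.PosSemidef) (h : Param np ny n)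
    {θ : Param np ny n} (hθ : StableMat (trans μ w θ)) (i j : StateIdx np ny n) :
    errCov μ w S h θ (i, j) = errCov μ w S h θ (j, i) := by
  have h1 := Pi.hasSum.mp (hasSum_errCov (μ := μ) (w := w) S h hθ)
  refine (h1 (i, j)).unique ((h1 (j, i)).congr_fun fun k => ?_)
  refine trans_pow_mulVec_symm θ (mom_mulVec_symm _ fun a b => ?_) k i j
  simpa [vecMat] using hS.isHermitian.apply b a

theorem errCov_eq (S : Matrix (Fin ny) (Fin ny) ℝ) (h : Param np ny n) {θ : Param np ny n}
    (hθ : StableMat (trans μ w θ)) : errCov μ w S h θ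
      = (trans μ w θ).mulVec (errCov μ w S h θ) + (gainMom μ w (h - θ)).mulVec (vecMat S) := by
  have h1 : (1 - trans μ w θ).mulVec (errCov μ w S h θ)
      = (gainMom μ w (h - θ)).mulVec (vecMat S) := by
    rw [errCov, Matrix.mulVec_mulVec, Matrix.mul_nonsing_inv _ hθ.isUnit_det, Matrix.one_mulVec]
  rw [← h1, Matrix.sub_mulVec, Matrix.one_mulVec]
  abel

/-- Moving the resolvent from the costate to the other factor turns the excess loss into the trace
of `E[c Δ cᵀ]` with `Δ` the nonnegative error covariance. -/
theorem trace_le_momLoss (hw : IsWhite μ w σ) {S : Matrix (Fin ny) (Fin ny) ℝ}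
    (hS : S.PosSemidef) (h : Param np ny n) {θ : Param np ny n} (hθ : StableMat (trans μ w θ)) :
    S.trace ≤ momLoss μ w S h θ := by
  rw [momLoss, costateSum, ← Matrix.dotProduct_mulVec, ← Matrix.dotProduct_mulVec]
  refine le_add_of_nonneg_right ?_
  simp only [dotProduct, vecOne, Fintype.sum_prod_type, ite_mul, one_mul, zero_mul,
    Finset.sum_ite_eq, Finset.mem_univ, if_true]
  refine Finset.sum_nonneg fun a _ => ?_
  rw [← qf_single ((outMom ny n μ w).mulVec _) a]
  exact qf_mom_mulVec_nonneg (hw.l2Mat_lin _) (qf_errCov_nonneg hw hS h hθ) _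

theorem gainMat_zero : gainMat (0 : Param np ny n) = 0 := rfl

theorem momLoss_self (S : Matrix (Fin ny) (Fin ny) ℝ) (h : Param np ny n) :
    momLoss μ w S h h = S.trace := by
  have : gainMom μ w (0 : Param np ny n) = 0 := by
    ext x y
    simp [gainMom, mom_apply, gainMat_zero, lin_apply]
  simp [momLoss, this]

end Loss

end LPVMA

namespace LPVMA

/-! ### Stationary points of the loss -/

section MixedMoments

variable {Ω : Type*} [MeasurableSpace Ω] {μ : Measure Ω} {κ ι Z : Type*} [Fintype ι] [Fintype Z]

omit [Fintype ι] in
theorem mom_sub_smul {B B' : Ω → Matrix κ ι ℝ} (hB : L2Mat μ B) (hB' : L2Mat μ B') (s : ℝ) :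
    mom μ (fun ω => B ω - s • B' ω)
      = mom μ B - s • (mom₂ μ B B' + mom₂ μ B' B) + s ^ 2 • mom μ B' := by
  ext x y
  simp only [mom_apply, mom₂, Matrix.of_apply, Matrix.sub_apply, Matrix.add_apply,
    Matrix.smul_apply, smul_eq_mul]
  have h1 : Integrable (fun ω => B ω x.1 y.1 * B ω x.2 y.2) μ := (hB _ _).integrable_mul (hB _ _)
  have h2 : Integrable (fun ω => B ω x.1 y.1 * B' ω x.2 y.2) μ :=
    (hB _ _).integrable_mul (hB' _ _)
  have h3 : Integrable (fun ω => B' ω x.1 y.1 * B ω x.2 y.2) μ :=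
    (hB' _ _).integrable_mul (hB _ _)
  have h4 : Integrable (fun ω => B' ω x.1 y.1 * B' ω x.2 y.2) μ :=
    (hB' _ _).integrable_mul (hB' _ _)
  have h5 : Integrable (fun ω => s * (B ω x.1 y.1 * B' ω x.2 y.2 + B' ω x.1 y.1 * B ω x.2 y.2)) μ :=
    (h2.add h3).const_mul s
  have h6 : Integrable (fun ω => B ω x.1 y.1 * B ω x.2 y.2
      - s * (B ω x.1 y.1 * B' ω x.2 y.2 + B' ω x.1 y.1 * B ω x.2 y.2)) μ := h1.sub h5
  rw [← integral_add h2 h3, ← integral_const_mul, ← integral_const_mul,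
    ← integral_sub h1 h5, ← integral_add h6 (h4.const_mul _)]
  exact integral_congr_ae (ae_of_all _ fun ω => by ring)

theorem mom₂_swap_mulVec (B B' : Ω → Matrix κ ι ℝ) {X : ι × ι → ℝ}
    (hX : ∀ i j, X (i, j) = X (j, i)) (i j : κ) :
    (mom₂ μ B' B).mulVec X (i, j) = (mom₂ μ B B').mulVec X (j, i) := by
  simp only [Matrix.mulVec, dotProduct]
  refine Fintype.sum_equiv (Equiv.prodComm ι ι) _ _ fun x => ?_
  obtain ⟨a, b⟩ := x
  simp only [Equiv.prodComm_apply, Prod.swap_prod_mk, mom₂, Matrix.of_apply, hX a b, mul_comm]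

theorem mom₂_mulVec_of_sum {M : Ω → Matrix κ ι ℝ} (hM : L2Mat μ M) {f : Z → Ω → ι → ℝ}
    (hf : ∀ z l, MemLp (fun ω => f z ω l) 2 μ) {g : Z → κ → ℝ} {F : Ω → Matrix κ ι ℝ}
    (hF : ∀ ω j l, F ω j l = ∑ z, g z j * f z ω l) (X : ι × ι → ℝ) (i j : κ) :
    (mom₂ μ M F).mulVec X (i, j)
      = ∑ z, (∑ y, (∫ ω, M ω i y.1 * f z ω y.2 ∂μ) * X y) * g z j := by
  have h : ∀ y, mom₂ μ M F (i, j) y = ∑ z, g z j * ∫ ω, M ω i y.1 * f z ω y.2 ∂μ := by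
    intro y
    simp only [mom₂, Matrix.of_apply, hF, Finset.mul_sum]
    rw [integral_finsetSum]
    · refine Finset.sum_congr rfl fun z _ => ?_
      rw [← integral_const_mul]
      exact integral_congr_ae (ae_of_all _ fun ω => by ring)
    · intro z _
      exact (hM _ _).integrable_mul ((hf _ _).const_mul _)
  simp only [Matrix.mulVec, dotProduct, h, Finset.sum_mul]
  rw [Finset.sum_comm]
  exact Finset.sum_congr rfl fun z _ => Finset.sum_congr rfl fun y _ => by ring

theorem dotProduct_neg_symm (y m : ι × ι → ℝ) (r : Z → ι → ℝ)
    (hm : ∀ i j, m (i, j) = ∑ z, r z i * r z j) :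
    dotProduct y (fun x => -(m x + m x.swap)) = -2 * ∑ z, qf y (r z) := by
  simp only [dotProduct, Fintype.sum_prod_type, Prod.swap_prod_mk, hm, qf,
    ← Finset.sum_add_distrib, Finset.mul_sum, ← Finset.sum_neg_distrib]
  conv_rhs => rw [Finset.sum_comm]
  refine Finset.sum_congr rfl fun i _ => ?_
  rw [Finset.sum_comm]
  exact Finset.sum_congr rfl fun z _ => Finset.sum_congr rfl fun j _ => by ring

end MixedMoments

section Stationary

variable {Ω : Type*} [MeasurableSpace Ω] {np ny n : ℕ} {μ : Measure Ω}
  {w : Ω → Fin (np + 1) → ℝ} {σ : Fin (np + 1) → ℝ}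

/-- The difference of two losses in terms of the one-step change of the error covariance. -/
theorem momLoss_sub_momLoss (S : Matrix (Fin ny) (Fin ny) ℝ) (h : Param np ny n)
    {θ θ' : Param np ny n} (hθ' : StableMat (trans μ w θ')) :
    momLoss μ w S h θ' - momLoss μ w S h θ = dotProduct (costateSum μ w θ')
      ((trans μ w θ').mulVec (errCov μ w S h θ) + (gainMom μ w (h - θ')).mulVec (vecMat S)
        - errCov μ w S h θ) := by
  have h1 : Matrix.vecMul (costateSum μ w θ') (1 - trans μ w θ')
      = Matrix.vecMul (vecOne (Fin ny)) (outMom ny n μ w) := by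
    rw [costateSum, Matrix.vecMul_vecMul _ _ (1 - trans μ w θ'),
      Matrix.nonsing_inv_mul _ hθ'.isUnit_det, Matrix.vecMul_one]
  -- The excess loss at `θ` is the output form paired with `Δ(θ)`; by `h1` the output form is also
  -- `Y(θ') (1 - T(θ'))`.
  have h2 : dotProduct (costateSum μ w θ) ((gainMom μ w (h - θ)).mulVec (vecMat S))
      = dotProduct (costateSum μ w θ') ((1 - trans μ w θ').mulVec (errCov μ w S h θ)) := by
    rw [Matrix.dotProduct_mulVec (costateSum μ w θ'), h1, costateSum, ← Matrix.dotProduct_mulVec,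
      errCov]
  rw [momLoss, momLoss, h2, Matrix.sub_mulVec, Matrix.one_mulVec]
  simp only [dotProduct_add, dotProduct_sub]
  ring

/-- The gain perturbation of the error transition. -/
def pertMat (v : Param np ny n) (w : Fin (np + 1) → ℝ) :
    Matrix (StateIdx np ny n) (StateIdx np ny n) ℝ :=
  lin (gainMat v) w * lin (outMat ny n) w

theorem lin_gainMat_add_smul (θ v : Param np ny n) (s : ℝ) (w : Fin (np + 1) → ℝ) :
    lin (gainMat (θ + s • v)) w = lin (gainMat θ) w + s • lin (gainMat v) w := by
  ext i b
  simp only [lin_apply, Matrix.add_apply, Matrix.smul_apply, smul_eq_mul, Finset.mul_sum,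
    ← Finset.sum_add_distrib]
  refine Finset.sum_congr rfl fun x _ => ?_
  simp only [gainMat, Matrix.of_apply, Pi.add_apply, Pi.smul_apply, smul_eq_mul]
  ring

theorem errMat_add_smul (θ v : Param np ny n) (s : ℝ) (w : Fin (np + 1) → ℝ) :
    errMat (θ + s • v) w = errMat θ w - s • pertMat v w := by
  rw [errMat, errMat, pertMat, lin_gainMat_add_smul, Matrix.add_mul, Matrix.smul_mul]
  abel

/-- Half of the first-order change of the error covariance in one step, before symmetrization. -/
noncomputable def mixVec (μ : Measure Ω) (w : Ω → Fin (np + 1) → ℝ)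
    (S : Matrix (Fin ny) (Fin ny) ℝ) (h θ v : Param np ny n) :
    StateIdx np ny n × StateIdx np ny n → ℝ :=
  (mom₂ μ (fun ω => errMat θ (w ω)) fun ω => pertMat v (w ω)).mulVec (errCov μ w S h θ)
    + (mom₂ μ (fun ω => lin (gainMat (h - θ)) (w ω))
        fun ω => lin (gainMat v) (w ω)).mulVec (vecMat S)

/-- The second-order change of the error covariance in one step. -/
noncomputable def quadVec (μ : Measure Ω) (w : Ω → Fin (np + 1) → ℝ)
    (S : Matrix (Fin ny) (Fin ny) ℝ) (h θ v : Param np ny n) :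
    StateIdx np ny n × StateIdx np ny n → ℝ :=
  (mom μ fun ω => pertMat v (w ω)).mulVec (errCov μ w S h θ)
    + (gainMom μ w v).mulVec (vecMat S)

/-- The first-order change of the error covariance in one step. -/
noncomputable def gradVec (μ : Measure Ω) (w : Ω → Fin (np + 1) → ℝ)
    (S : Matrix (Fin ny) (Fin ny) ℝ) (h θ v : Param np ny n) :
    StateIdx np ny n × StateIdx np ny n → ℝ :=
  fun x => -(mixVec μ w S h θ v x + mixVec μ w S h θ v x.swap)

/-- Error transition and gain mismatch are affine in `s`, so their second moments are quadratic. The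
constant term cancels by the Lyapunov equation `errCov_eq`; symmetry of `Δ` and `S` makes the two
mixed moments transposes of each other. -/
theorem one_step_increment (hw : IsWhite μ w σ) {S : Matrix (Fin ny) (Fin ny) ℝ}
    (hS : S.PosSemidef) (h : Param np ny n) {θ : Param np ny n} (hθ : StableMat (trans μ w θ))
    (v : Param np ny n) (s : ℝ) :
    (trans μ w (θ + s • v)).mulVec (errCov μ w S h θ)
        + (gainMom μ w (h - (θ + s • v))).mulVec (vecMat S) - errCov μ w S h θ
      = s • gradVec μ w S h θ v + s ^ 2 • quadVec μ w S h θ v := by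
  have h1 : trans μ w (θ + s • v) = trans μ w θ
      - s • (mom₂ μ (fun ω => errMat θ (w ω)) (fun ω => pertMat v (w ω))
        + mom₂ μ (fun ω => pertMat v (w ω)) (fun ω => errMat θ (w ω)))
      + s ^ 2 • mom μ (fun ω => pertMat v (w ω)) := by
    rw [trans]
    simp only [errMat_add_smul]
    exact mom_sub_smul (l2Mat_errMat hw θ) (hw.l2Mat_lin_mul_lin _ _) s
  have h2 : gainMom μ w (h - (θ + s • v)) = gainMom μ w (h - θ)
      - s • (mom₂ μ (fun ω => lin (gainMat (h - θ)) (w ω)) (fun ω => lin (gainMat v) (w ω))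
        + mom₂ μ (fun ω => lin (gainMat v) (w ω)) (fun ω => lin (gainMat (h - θ)) (w ω)))
      + s ^ 2 • gainMom μ w v := by
    have h3 : ∀ ω, lin (gainMat (h - (θ + s • v))) (w ω)
        = lin (gainMat (h - θ)) (w ω) - s • lin (gainMat v) (w ω) := fun ω => by
      have : h - (θ + s • v) = (h - θ) + (-s) • v := by
        rw [neg_smul]
        abel
      rw [this, lin_gainMat_add_smul, neg_smul, ← sub_eq_add_neg]
    rw [gainMom]
    simp only [h3]
    exact mom_sub_smul (hw.l2Mat_lin _) (hw.l2Mat_lin _) s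
  have h4 := errCov_eq S h hθ
  have hsym : ∀ a b : Fin ny, vecMat S (a, b) = vecMat S (b, a) := fun a b => by
    simpa [vecMat] using hS.isHermitian.apply b a
  funext x
  obtain ⟨i, j⟩ := x
  have h5 := congrFun h4 (i, j)
  have e1 := mom₂_swap_mulVec (μ := μ) (fun ω => errMat θ (w ω)) (fun ω => pertMat v (w ω))
    (errCov_symm hS h hθ) i j
  have e2 := mom₂_swap_mulVec (μ := μ) (fun ω => lin (gainMat (h - θ)) (w ω))
    (fun ω => lin (gainMat v) (w ω)) hsym i j
  rw [h1, h2]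
  simp only [Matrix.add_mulVec, Matrix.sub_mulVec, Matrix.smul_mulVec, Pi.add_apply, Pi.sub_apply,
    Pi.smul_apply, smul_eq_mul, gradVec, quadVec, mixVec, Prod.swap_prod_mk] at h5 ⊢
  rw [e1, e2]
  linarith

/-- The difference formula is exact, so after division by `s` only continuity of the costate is
needed, not its derivative. -/
theorem dotProduct_gradVec_eq_zero (hw : IsWhite μ w σ) {S : Matrix (Fin ny) (Fin ny) ℝ}
    (hS : S.PosSemidef) (h : Param np ny n) {θ : Param np ny n} (hθ : StableMat (trans μ w θ))
    (v : Param np ny n) (hv : HasDerivAt (fun s : ℝ => momLoss μ w S h (θ + s • v)) 0 0) :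
    dotProduct (costateSum μ w θ) (gradVec μ w S h θ v) = 0 := by
  have hline : Tendsto (fun s : ℝ => θ + s • v) (𝓝[≠] 0) (𝓝 θ) := by
    have : Continuous fun s : ℝ => θ + s • v := by fun_prop
    have h1 := this.tendsto 0
    simp only [zero_smul, add_zero] at h1
    exact h1.mono_left nhdsWithin_le_nhds
  have hstab : ∀ᶠ s in 𝓝[≠] (0 : ℝ), StableMat (trans μ w (θ + s • v)) :=
    hline.eventually ((isOpen_stableMat_trans hw).mem_nhds hθ)
  rw [hasDerivAt_iff_tendsto_slope_zero] at hv
  refine tendsto_nhds_unique (f := fun s : ℝ => dotProduct (costateSum μ w (θ + s • v))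
    (gradVec μ w S h θ v + s • quadVec μ w S h θ v)) (l := 𝓝[≠] 0) ?_ (hv.congr' ?_)
  · simp only [dotProduct]
    refine tendsto_finsetSum _ fun x _ => ?_
    have h1 : Tendsto (fun s : ℝ => costateSum μ w (θ + s • v) x) (𝓝[≠] 0)
        (𝓝 (costateSum μ w θ x)) :=
      (differentiableAt_costateSum hw hθ x).continuousAt.tendsto.comp hline
    have h2 : Tendsto (fun s : ℝ => (gradVec μ w S h θ v + s • quadVec μ w S h θ v) x) (𝓝[≠] 0)
        (𝓝 (gradVec μ w S h θ v x)) := by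
      have h3 : Continuous fun s : ℝ => (gradVec μ w S h θ v + s • quadVec μ w S h θ v) x := by
        simp only [Pi.add_apply, Pi.smul_apply, smul_eq_mul]
        fun_prop
      have h4 := h3.tendsto 0
      simp only [zero_smul, add_zero] at h4
      exact h4.mono_left nhdsWithin_le_nhds
    exact h1.mul h2
  · filter_upwards [hstab, self_mem_nhdsWithin] with s hs hs0
    rw [zero_add, zero_smul, add_zero, momLoss_sub_momLoss S h hs,
      one_step_increment hw hS h hθ, smul_eq_mul, ← smul_eq_mul, ← dotProduct_smul, smul_add,
      smul_smul, smul_smul, inv_mul_cancel₀ hs0, one_smul, sq, inv_mul_cancel_left₀ hs0]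

/-- The normal equations of the one-step minimization of the error covariance. -/
theorem mixVec_eq_zero (hw : IsWhite μ w σ) {S : Matrix (Fin ny) (Fin ny) ℝ}
    (h : Param np ny n) {θ : Param np ny n} (hθ : StableMat (trans μ w θ))
    (hgrad : ∀ v, dotProduct (costateSum μ w θ) (gradVec μ w S h θ v) = 0) (v : Param np ny n) :
    mixVec μ w S h θ v = 0 := by
  -- The mixed moment is linear in the gain of `v`, and `E` is its coefficient: the columns of `E`
  -- carry the first index, those of the gain the second.
  let E : Fin (np + 1) → Matrix (StateIdx np ny n) (Fin ny) ℝ := fun x => Matrix.of fun i a =>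
    (∑ y, (∫ ω, errMat θ (w ω) i y.1 * (w ω x * lin (outMat ny n) (w ω) a y.2) ∂μ)
        * errCov μ w S h θ y)
      + ∑ y, (∫ ω, lin (gainMat (h - θ)) (w ω) i y.1
        * (w ω x * (1 : Matrix (Fin ny) (Fin ny) ℝ) a y.2) ∂μ) * vecMat S y
  have hmix : ∀ v i j, mixVec μ w S h θ v (i, j)
      = ∑ z : Fin (np + 1) × Fin ny, E z.1 i z.2 * gainMat v z.1 j z.2 := by
    intro v i j
    rw [mixVec, Pi.add_apply,
      mom₂_mulVec_of_sum (Z := Fin (np + 1) × Fin ny) (l2Mat_errMat hw θ)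
        (f := fun z ω l => w ω z.1 * lin (outMat ny n) (w ω) z.2 l)
        (g := fun z j => gainMat v z.1 j z.2) ?_ ?_,
      mom₂_mulVec_of_sum (Z := Fin (np + 1) × Fin ny) (hw.l2Mat_lin _)
        (f := fun z ω l => w ω z.1 * (1 : Matrix (Fin ny) (Fin ny) ℝ) z.2 l)
        (g := fun z j => gainMat v z.1 j z.2) ?_ ?_, ← Finset.sum_add_distrib]
    · exact Finset.sum_congr rfl fun z _ => (add_mul _ _ _).symm
    · exact fun z l => (hw.memLp z.1).mul_const _
    · intro ω j l
      rw [lin_apply, Fintype.sum_prod_type]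
      refine Finset.sum_congr rfl fun x _ => ?_
      simp [Matrix.one_apply, mul_comm]
    · intro z l
      simp only [lin_apply, Finset.mul_sum, ← mul_assoc]
      exact memLp_finsetSum _ fun y _ => (hw.memLp_mul _ _).mul_const _
    · intro ω j l
      simp only [pertMat, Matrix.mul_apply, Fintype.sum_prod_type]
      rw [Finset.sum_comm]
      refine Finset.sum_congr rfl fun a _ => ?_
      rw [lin_apply, Finset.sum_mul]
      exact Finset.sum_congr rfl fun x _ => by ring
  have hE0 : ∀ z : Fin (np + 1) × Fin ny, (fun i => E z.1 i z.2) = 0 := by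
    obtain ⟨⟨c, hc, hcY⟩, h0⟩ := exists_pos_mul_le_qf_of_hasSum_costate hw θ (hasSum_costate hθ)
    have hnn : ∀ v, 0 ≤ qf (costateSum μ w θ) v := fun v =>
      (hasSum_qf (hasSum_costate hθ) v).nonneg fun k => qf_costate_nonneg hw θ k v
    -- The direction with gain `E` itself turns the derivative into `-2` times a sum of values of
    -- the positive definite form `Y` at the columns of `E`.
    have h1 := hgrad (paramOfGain E)
    have h2 : dotProduct (costateSum μ w θ) (gradVec μ w S h θ (paramOfGain E))
        = -2 * ∑ z : Fin (np + 1) × Fin ny, qf (costateSum μ w θ) fun i => E z.1 i z.2 := by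
      refine dotProduct_neg_symm _ _ _ fun i j => ?_
      rw [hmix, gainMat_paramOfGain]
    rw [h2] at h1
    have h3 : ∑ z : Fin (np + 1) × Fin ny, qf (costateSum μ w θ) (fun i => E z.1 i z.2) = 0 := by
      linarith
    rw [Finset.sum_eq_zero_iff_of_nonneg fun z _ => hnn _] at h3
    exact fun z => h0 _ (h3 z (Finset.mem_univ _))
  funext x
  obtain ⟨i, j⟩ := x
  rw [hmix]
  refine Finset.sum_eq_zero fun z _ => ?_
  rw [show E z.1 i z.2 = 0 from congrFun (hE0 z) i, zero_mul]

/-- The loss has no stationary point but the true parameter vector. -/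
theorem eq_of_stationary (hw : IsWhite μ w σ) {S : Matrix (Fin ny) (Fin ny) ℝ} (hS : S.PosDef)
    {h θ : Param np ny n} (hθ : StableMat (trans μ w θ)) (hh : StableMat (trans μ w h))
    (hstat : ∀ v, HasDerivAt (fun s : ℝ => momLoss μ w S h (θ + s • v)) 0 0) : θ = h := by
  have hS' := hS.posSemidef
  have hmix := mixVec_eq_zero (S := S) hw h hθ fun v =>
    dotProduct_gradVec_eq_zero hw hS' h hθ v (hstat v)
  have hΔ := qf_errCov_nonneg hw hS' h hθ
  -- The full step `s = 1` in direction `h - θ` ends at `h`, where the gain mismatch is zero; its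
  -- linear term vanishes by `hmix`.
  have hstep : (trans μ w h).mulVec (errCov μ w S h θ)
      = errCov μ w S h θ + quadVec μ w S h θ (h - θ) := by
    have h1 := one_step_increment hw hS' h hθ (h - θ) 1
    have h2 : gradVec μ w S h θ (h - θ) = 0 := by
      funext x
      simp [gradVec, hmix]
    have h3 : gainMom μ w (0 : Param np ny n) = 0 := by
      ext x y
      simp [gainMom, mom_apply, gainMat_zero, lin_apply]
    simp only [one_smul, one_pow, add_sub_cancel, sub_self, h2, h3, Matrix.zero_mulVec, add_zero,
      zero_add] at h1
    rw [← h1]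
    abel
  have hquad : ∀ v, 0 ≤ qf (quadVec μ w S h θ (h - θ)) v := fun v => by
    rw [quadVec, qf_add]
    exact add_nonneg (qf_mom_mulVec_nonneg (hw.l2Mat_lin_mul_lin _ _) hΔ v)
      (qf_gainMom_mulVec_nonneg hw hS' _ v)
  have hmono : ∀ k v, qf (errCov μ w S h θ) v
      ≤ qf ((trans μ w h ^ k).mulVec (errCov μ w S h θ)) v := by
    intro k
    induction k with
    | zero => simp
    | succ k ih =>
      intro v
      rw [pow_succ, ← Matrix.mulVec_mulVec, hstep, Matrix.mulVec_add, qf_add]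
      linarith [ih v, qf_trans_pow_mulVec_nonneg hw h hquad k v]
  have hzero : ∀ v, qf (errCov μ w S h θ) v = 0 := by
    intro v
    refine le_antisymm ?_ (hΔ v)
    refine ge_of_tendsto' (x := atTop) ?_ fun k => hmono k v
    have h1 : ∀ x, Tendsto (fun k => (trans μ w h ^ k).mulVec (errCov μ w S h θ) x) atTop
        (𝓝 0) := by
      intro x
      have h2 : Tendsto (fun k => ∑ y, (trans μ w h ^ k) x y * errCov μ w S h θ y) atTop
          (𝓝 (∑ y, 0 * errCov μ w S h θ y)) :=
        tendsto_finsetSum _ fun y _ =>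
          ((tendsto_pi_nhds.mp (tendsto_pi_nhds.mp hh x) y).mul_const _)
      simp only [zero_mul, Finset.sum_const_zero] at h2
      exact h2
    have h3 : Tendsto (fun k => qf ((trans μ w h ^ k).mulVec (errCov μ w S h θ)) v) atTop
        (𝓝 (∑ i, ∑ j, v i * 0 * v j)) :=
      tendsto_finsetSum _ fun i _ => tendsto_finsetSum _ fun j _ =>
        ((h1 (i, j)).const_mul _).mul_const _
    simpa using h3
  -- With `Δ = 0` as a form, both nonnegative parts of the Lyapunov equation vanish, in particular
  -- `E[K S Kᵀ]` for the mismatch `K`.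
  have hgain : ∀ x v, (gainMat (h - θ) x).transpose.mulVec v = 0 := by
    intro x v
    have h1 := errCov_eq (μ := μ) (w := w) S h hθ
    have h2 : qf ((gainMom μ w (h - θ)).mulVec (vecMat S)) v = 0 := by
      have h3 := hzero v
      rw [h1, qf_add] at h3
      have h4 : 0 ≤ qf ((trans μ w θ).mulVec (errCov μ w S h θ)) v :=
        qf_mom_mulVec_nonneg (l2Mat_errMat hw θ) hΔ v
      linarith [qf_gainMom_mulVec_nonneg hw hS' (h - θ) v]
    rw [gainMom, qf_mom_mulVec (hw.l2Mat_lin _)] at h2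
    have h5 : ∀ ω, (lin (gainMat (h - θ)) (w ω)).transpose.mulVec v
        = ∑ x, w ω x • (gainMat (h - θ) x).transpose.mulVec v := fun ω => by
      rw [← lin_mulVec fun x => (gainMat (h - θ) x).transpose]
      simp [lin, Matrix.transpose_sum]
    simp only [h5] at h2
    rw [hw.integral_qf_lin, Finset.sum_eq_zero_iff_of_nonneg
      fun x _ => mul_nonneg (hw.pos x).le (qf_vecMat_nonneg hS' _)] at h2
    exact eq_zero_of_qf_vecMat hS
      ((mul_eq_zero.mp (h2 x (Finset.mem_univ _))).resolve_left (hw.pos x).ne')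
  have hfin : gainMat (h - θ) = gainMat (0 : Param np ny n) := by
    funext x
    ext i b
    have h1 := congrFun (hgain x (Pi.single i 1)) b
    simpa [gainMat_zero] using h1
  exact (sub_eq_zero.mp (gainMat_injective hfin)).symm

end Stationary

end LPVMA

namespace LPVMA

/-! ### Scheduling processes: independence and second moments of products -/

theorem indepFun_of_indep {Ω : Type*} {m₁ m₂ : MeasurableSpace Ω} [MeasurableSpace Ω]
    {μ : Measure Ω} (h : Indep m₁ m₂ μ) {f g : Ω → ℝ}
    (hf : Measurable[m₁] f) (hg : Measurable[m₂] g) : IndepFun f g μ := by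
  rw [IndepFun_iff_Indep]
  exact indep_of_indep_of_le h (Measurable.comap_le hf) (Measurable.comap_le hg)

/-- The second moment of the product factors, so no higher moments are needed across different
times. -/
theorem memLp_two_mul_of_indep {Ω : Type*} {m₁ m₂ : MeasurableSpace Ω} [MeasurableSpace Ω]
    {μ : Measure Ω} (h : Indep m₁ m₂ μ) {f g : Ω → ℝ}
    (hf : Measurable[m₁] f) (hg : Measurable[m₂] g) (hf2 : MemLp f 2 μ) (hg2 : MemLp g 2 μ) :
    MemLp (fun ω => f ω * g ω) 2 μ := by
  have hm : AEStronglyMeasurable (fun ω => f ω * g ω) μ :=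
    hf2.aestronglyMeasurable.mul hg2.aestronglyMeasurable
  rw [memLp_two_iff_integrable_sq hm]
  have := (indepFun_of_indep h (hf.pow_const 2) (hg.pow_const 2)).integrable_mul
    hf2.integrable_sq hg2.integrable_sq
  refine this.congr (ae_of_all _ fun ω => ?_)
  simp [mul_pow]

section Scheduling

variable {Ω : Type*} [MeasurableSpace Ω] {μ : Measure Ω} [IsProbabilityMeasure μ] {np ny M : ℕ}
  {p : Fin np → ℤ → Ω → ℝ} {e : ℤ → Ω → Fin ny → ℝ}

/-- The scheduling vector at a fixed time is white. -/
theorem IsSchedulingNoise.isWhite (hp : IsSchedulingNoise μ p e M) (hM : 4 ≤ M) :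
    IsWhite μ (fun ω => schedVec (traj p ω) 0) fun a => ∫ ω, schedVec (traj p ω) 0 a ^ 2 ∂μ := by
  have h0 : ∀ ω, schedVec (traj p ω) 0 0 = 1 := fun _ => rfl
  have hs : ∀ (i : Fin np) ω, schedVec (traj p ω) 0 i.succ = p i 0 ω := fun _ _ => rfl
  have hL : ∀ i, MemLp (fun ω => p i 0 ω) 2 μ := fun i => by
    rw [memLp_two_iff_integrable_sq (hp.measurable i 0).aestronglyMeasurable]
    simpa using hp.moments i i 0 2 0 (by norm_num) (by omega)
  refine ⟨fun a => ?_, fun a b => ?_, fun a b => ?_, fun a => ?_⟩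
  · refine Fin.cases ?_ (fun i => ?_) a
    · simp only [h0]
      exact memLp_const _
    · exact hL i
  · refine Fin.cases ?_ (fun i => ?_) a
    · refine Fin.cases ?_ (fun j => ?_) b
      · simp only [h0]
        exact memLp_const _
      · simp only [h0, hs, one_mul]
        exact hL j
    · refine Fin.cases ?_ (fun j => ?_) b
      · simp only [h0, hs, mul_one]
        exact hL i
      · simp only [hs]
        have hm : AEStronglyMeasurable (fun ω => p i 0 ω * p j 0 ω) μ :=
          ((hp.measurable i 0).mul (hp.measurable j 0)).aestronglyMeasurable
        rw [memLp_two_iff_integrable_sq hm]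
        -- The only use of moments of order four.
        simpa only [mul_pow] using hp.moments i j 0 2 2 (by norm_num) (by omega)
  · by_cases hab : a = b
    · subst hab
      simp only [if_true, sq]
    · rw [if_neg hab]
      revert hab
      refine Fin.cases ?_ (fun i => ?_) a
      · refine Fin.cases (fun h => absurd rfl h) (fun j _ => ?_) b
        simp only [h0, hs, one_mul, hp.mean]
      · refine Fin.cases (fun _ => ?_) (fun j hij => ?_) b
        · simp only [h0, hs, mul_one, hp.mean]
        · have hne : ((i, 0) : Fin np × ℤ) ≠ (j, 0) := fun h =>
            hij (congrArg Fin.succ (Prod.ext_iff.mp h).1)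
          have := (hp.indep.indepFun hne).integral_fun_mul_eq_mul_integral
            (hp.measurable i 0).aestronglyMeasurable (hp.measurable j 0).aestronglyMeasurable
          simp only [hs]
          rw [this, hp.mean, zero_mul]
  · refine Fin.cases ?_ (fun i => ?_) a
    · simp [h0]
    · simpa only [hs] using hp.variance_pos i 0

omit [IsProbabilityMeasure μ] in
theorem IsSchedulingNoise.identDistrib_schedVec (hp : IsSchedulingNoise μ p e M) (t : ℤ) :
    IdentDistrib (fun ω => schedVec (traj p ω) t) (fun ω => schedVec (traj p ω) 0) μ μ := by
  have hinj : ∀ t : ℤ, Function.Injective fun i : Fin np => ((i, t) : Fin np × ℤ) :=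
    fun t i j h => (Prod.ext_iff.mp h).1
  have h1 : IdentDistrib (fun ω (i : Fin np) => p i t ω) (fun ω (i : Fin np) => p i 0 ω) μ μ :=
    IdentDistrib.pi (fun i => hp.identDistrib i t 0) (hp.indep.precomp (hinj t))
      (hp.indep.precomp (hinj 0))
  refine h1.comp (u := fun (x : Fin np → ℝ) (a : Fin (np + 1)) =>
    Fin.cases (motive := fun _ => ℝ) 1 x a) (measurable_pi_lambda _ fun a => ?_)
  refine Fin.cases ?_ (fun i => ?_) a
  · exact measurable_const
  · exact measurable_pi_apply i

/-- The `σ`-algebra of the scheduling signals at the times in `s`. -/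
@[reducible] def schedAlg (p : Fin np → ℤ → Ω → ℝ) (s : Set ℤ) : MeasurableSpace Ω :=
  ⨆ x ∈ {x : Fin np × ℤ | x.2 ∈ s}, MeasurableSpace.comap (p x.1 x.2) inferInstance

omit [MeasurableSpace Ω] in
theorem schedAlg_mono {s s' : Set ℤ} (h : s ⊆ s') : schedAlg p s ≤ schedAlg p s' :=
  biSup_mono fun _ hx => h hx

omit [IsProbabilityMeasure μ] in
theorem IsSchedulingNoise.indep_schedAlg (hp : IsSchedulingNoise μ p e M) {s s' : Set ℤ}
    (h : Disjoint s s') : Indep (schedAlg p s) (schedAlg p s') μ :=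
  indep_iSup_of_disjoint
    (m := fun x : Fin np × ℤ => MeasurableSpace.comap (p x.1 x.2) inferInstance)
    (S := {x | x.2 ∈ s}) (T := {x | x.2 ∈ s'})
    (fun x => (hp.measurable x.1 x.2).comap_le) hp.indep.iIndep
    (Set.disjoint_left.mpr fun _ hx hx' => Set.disjoint_left.mp h hx hx')

omit [MeasurableSpace Ω] in
theorem schedAlg_le_comap (s : Set ℤ) : schedAlg p s
    ≤ MeasurableSpace.comap (fun ω (x : Fin np × ℤ) => p x.1 x.2 ω) inferInstance := by
  refine iSup₂_le fun x _ => ?_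
  rintro _ ⟨A, hA, rfl⟩
  exact ⟨(fun f => f x) ⁻¹' A, measurable_pi_apply x hA, rfl⟩

omit [MeasurableSpace Ω] in
theorem measurable_schedAlg_schedVec {s : Set ℤ} {t : ℤ} (ht : t ∈ s) :
    Measurable[schedAlg p s] fun ω => schedVec (traj p ω) t := by
  refine @measurable_pi_lambda _ _ _ (schedAlg p s) _ _ fun a => ?_
  refine Fin.cases ?_ (fun i => ?_) a
  · exact measurable_const
  · refine Measurable.mono (comap_measurable (p i t)) ?_ le_rfl
    exact le_iSup₂_of_le (i, t) ht le_rfl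

/-- A random matrix that is a square integrable function of the scheduling signals at the times
`≥ r`, with second moment `X`. -/
structure HasMom {κ ι : Type*} (μ : Measure Ω) (p : Fin np → ℤ → Ω → ℝ) (r : ℤ)
    (W : Ω → Matrix κ ι ℝ) (X : Matrix (κ × κ) (ι × ι) ℝ) : Prop where
  meas : ∀ i j, Measurable[schedAlg p (Set.Ici r)] fun ω => W ω i j
  l2 : L2Mat μ W
  mom_eq : mom μ W = X

variable {κ ι ν : Type*} [Fintype ι]

omit [Fintype ι] in
theorem hasMom_one [DecidableEq ι] (r : ℤ) :
    HasMom μ p r (fun _ => (1 : Matrix ι ι ℝ)) 1 where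
  meas _ _ := measurable_const
  l2 _ _ := memLp_const _
  mom_eq := by
    ext x y
    obtain ⟨a, b⟩ := x
    obtain ⟨c, d⟩ := y
    simp [mom_apply, Matrix.one_apply, Prod.ext_iff, ← ite_and, and_comm]

omit [IsProbabilityMeasure μ] [Fintype ι] in
theorem HasMom.neg {r : ℤ} {W : Ω → Matrix κ ι ℝ} {X : Matrix (κ × κ) (ι × ι) ℝ}
    (hW : HasMom μ p r W X) : HasMom μ p r (fun ω => -W ω) X where
  meas i j := (hW.meas i j).neg
  l2 i j := (hW.l2 i j).neg
  mom_eq := by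
    rw [← hW.mom_eq]
    ext x y
    simp [mom_apply]

omit [Fintype ι] in
omit [IsProbabilityMeasure μ] in
theorem IsSchedulingNoise.l2Mat_comp (hp : IsSchedulingNoise μ p e M)
    {B : (Fin (np + 1) → ℝ) → Matrix ι ν ℝ} (hBm : ∀ i j, Measurable fun w => B w i j)
    (hB : L2Mat μ fun ω => B (schedVec (traj p ω) 0)) (t : ℤ) :
    L2Mat μ fun ω => B (schedVec (traj p ω) t) := fun i j =>
  (((hp.identDistrib_schedVec t).comp (hBm i j)).memLp_iff).mpr (hB i j)

omit [Fintype ι] in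
omit [IsProbabilityMeasure μ] in
theorem IsSchedulingNoise.mom_comp (hp : IsSchedulingNoise μ p e M)
    {B : (Fin (np + 1) → ℝ) → Matrix ι ν ℝ} (hBm : ∀ i j, Measurable fun w => B w i j) (t : ℤ) :
    mom μ (fun ω => B (schedVec (traj p ω) t)) = mom μ fun ω => B (schedVec (traj p ω) 0) := by
  ext x y
  exact ((hp.identDistrib_schedVec t).comp ((hBm x.1 y.1).mul (hBm x.2 y.2))).integral_eq

omit [Fintype ι] in
omit [IsProbabilityMeasure μ] in
theorem IsSchedulingNoise.hasMom (hp : IsSchedulingNoise μ p e M)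
    {B : (Fin (np + 1) → ℝ) → Matrix ι ν ℝ} (hBm : ∀ i j, Measurable fun w => B w i j)
    (hB : L2Mat μ fun ω => B (schedVec (traj p ω) 0)) (t : ℤ) :
    HasMom μ p t (fun ω => B (schedVec (traj p ω) t))
      (mom μ fun ω => B (schedVec (traj p ω) 0)) where
  meas i j := (hBm i j).comp (measurable_schedAlg_schedVec (Set.self_mem_Ici))
  l2 := hp.l2Mat_comp hBm hB t
  mom_eq := hp.mom_comp hBm t

omit [IsProbabilityMeasure μ] in
-- `W` sees only times after `r` and the new factor only time `r`, so independence splits the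
-- expectation of the Kronecker square.
theorem HasMom.mul (hp : IsSchedulingNoise μ p e M) {r : ℤ} {W : Ω → Matrix κ ι ℝ}
    {X : Matrix (κ × κ) (ι × ι) ℝ} (hW : HasMom μ p (r + 1) W X)
    {B : (Fin (np + 1) → ℝ) → Matrix ι ν ℝ} (hBm : ∀ i j, Measurable fun w => B w i j)
    (hB : L2Mat μ fun ω => B (schedVec (traj p ω) 0)) :
    HasMom μ p r (fun ω => W ω * B (schedVec (traj p ω) r))
      (X * mom μ fun ω => B (schedVec (traj p ω) 0)) := by
  have hind : Indep (schedAlg p (Set.Ici (r + 1))) (schedAlg p {r}) μ :=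
    hp.indep_schedAlg (Set.disjoint_singleton_right.mpr (by simp))
  have hBr : ∀ i j, Measurable[schedAlg p {r}] fun ω => B (schedVec (traj p ω) r) i j :=
    fun i j => (hBm i j).comp (measurable_schedAlg_schedVec (Set.mem_singleton r))
  have hB2 := hp.l2Mat_comp hBm hB r
  refine ⟨fun i j => ?_, fun i j => ?_, ?_⟩
  · simp only [Matrix.mul_apply]
    refine Finset.measurable_fun_sum _ fun k _ => Measurable.mul ?_ ?_
    · exact (hW.meas i k).mono (schedAlg_mono (Set.Ici_subset_Ici.mpr (by omega))) le_rfl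
    · exact (hBm k j).comp (measurable_schedAlg_schedVec (Set.self_mem_Ici))
  · simp only [Matrix.mul_apply]
    exact memLp_finsetSum _ fun k _ =>
      memLp_two_mul_of_indep hind (hW.meas i k) (hBr k j) (hW.l2 i k) (hB2 k j)
  · rw [← hW.mom_eq, ← hp.mom_comp hBm r]
    ext x y
    simp only [mom_apply, Matrix.mul_apply, Finset.sum_mul_sum, Fintype.sum_prod_type]
    have h1 : ∀ k l ω, W ω x.1 k * B (schedVec (traj p ω) r) k y.1
        * (W ω x.2 l * B (schedVec (traj p ω) r) l y.2)
        = (W ω x.1 k * W ω x.2 l) * (B (schedVec (traj p ω) r) k y.1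
          * B (schedVec (traj p ω) r) l y.2) := fun k l ω => by ring
    simp only [h1]
    have hI : ∀ k l, IndepFun (fun ω => W ω x.1 k * W ω x.2 l)
        (fun ω => B (schedVec (traj p ω) r) k y.1 * B (schedVec (traj p ω) r) l y.2) μ :=
      fun k l => indepFun_of_indep hind ((hW.meas _ _).mul (hW.meas _ _))
        ((hBr _ _).mul (hBr _ _))
    have hi1 : ∀ k l, Integrable (fun ω => W ω x.1 k * W ω x.2 l) μ :=
      fun k l => (hW.l2 _ _).integrable_mul (hW.l2 _ _)
    have hi2 : ∀ k l, Integrable (fun ω => B (schedVec (traj p ω) r) k y.1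
        * B (schedVec (traj p ω) r) l y.2) μ := fun k l => (hB2 _ _).integrable_mul (hB2 _ _)
    have hi3 : ∀ k l, Integrable (fun ω => (W ω x.1 k * W ω x.2 l)
        * (B (schedVec (traj p ω) r) k y.1 * B (schedVec (traj p ω) r) l y.2)) μ :=
      fun k l => (hI k l).integrable_mul (hi1 k l) (hi2 k l)
    rw [integral_finsetSum _ fun k _ => integrable_finsetSum _ fun l _ => hi3 k l]
    refine Finset.sum_congr rfl fun k _ => ?_
    rw [integral_finsetSum _ fun l _ => hi3 k l]
    exact Finset.sum_congr rfl fun l _ => (hI k l).integral_fun_mul_eq_mul_integral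
      (hi1 k l).aestronglyMeasurable (hi2 k l).aestronglyMeasurable

omit [IsProbabilityMeasure μ] in
theorem HasMom.mul_prodFrom [DecidableEq ι] (hp : IsSchedulingNoise μ p e M) {t : ℤ}
    {W : Ω → Matrix κ ι ℝ} {X : Matrix (κ × κ) (ι × ι) ℝ} (hW : HasMom μ p (t + 1) W X)
    {B : (Fin (np + 1) → ℝ) → Matrix ι ι ℝ} (hBm : ∀ i j, Measurable fun w => B w i j)
    (hB : L2Mat μ fun ω => B (schedVec (traj p ω) 0)) (k : ℕ) :
    HasMom μ p (t + 1 - k) (fun ω => W ω * prodFrom B (schedVec (traj p ω)) t k)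
      (X * (mom μ fun ω => B (schedVec (traj p ω) 0)) ^ k) := by
  induction k with
  | zero => simpa [prodFrom] using hW
  | succ k ih =>
    have h1 : t + 1 - ((k + 1 : ℕ) : ℤ) = t - k := by push_cast; ring
    have h2 : t + 1 - (k : ℤ) = t - k + 1 := by ring
    rw [h2] at ih
    have h3 := ih.mul hp hBm hB
    simp only [prodFrom, pow_succ, ← Matrix.mul_assoc, h1]
    exact h3

end Scheduling

/-! ### Second moments of the filter coefficients -/

section FilterMoments

variable {Ω : Type*} [MeasurableSpace Ω] {μ : Measure Ω} [IsProbabilityMeasure μ] {np ny n M : ℕ}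
  {p : Fin np → ℤ → Ω → ℝ} {e : ℤ → Ω → Fin ny → ℝ}

theorem measurable_lin_apply {κ ι : Type*} (B : Fin (np + 1) → Matrix κ ι ℝ) (i : κ) (j : ι) :
    Measurable fun w : Fin (np + 1) → ℝ => lin B w i j := by
  simp only [lin_apply]
  fun_prop

theorem measurable_lin_mul_lin_apply {κ ι ν : Type*} [Fintype ι] (B : Fin (np + 1) → Matrix κ ι ℝ)
    (B' : Fin (np + 1) → Matrix ι ν ℝ) (i : κ) (j : ν) :
    Measurable fun w : Fin (np + 1) → ℝ => (lin B w * lin B' w) i j := by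
  simp only [Matrix.mul_apply]
  exact Finset.measurable_fun_sum _ fun k _ =>
    (measurable_lin_apply B i k).mul (measurable_lin_apply B' k j)

theorem measurable_errMat_apply (θ : Param np ny n) (i j : StateIdx np ny n) :
    Measurable fun w : Fin (np + 1) → ℝ => errMat θ w i j :=
  (measurable_lin_apply _ i j).sub (measurable_lin_mul_lin_apply _ _ i j)

/-- The scheduling vector at time zero. -/
def sched₀ (p : Fin np → ℤ → Ω → ℝ) (ω : Ω) : Fin (np + 1) → ℝ := schedVec (traj p ω) 0

variable (hp : IsSchedulingNoise μ p e M) (hM : 4 ≤ M)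

include hp hM

/-- Realizing the powers as moments of actual random matrices gives nonnegative diagonal entries
that dominate the others. -/
theorem exists_mom_eq_trans_pow (θ : Param np ny n) (k : ℕ) :
    ∃ W : Ω → Matrix (StateIdx np ny n) (StateIdx np ny n) ℝ,
      L2Mat μ W ∧ mom μ W = trans μ (sched₀ p) θ ^ k := by
  have h := (hasMom_one (μ := μ) (p := p) (ι := StateIdx np ny n) (0 + 1)).mul_prodFrom hp
    (measurable_errMat_apply θ) (l2Mat_errMat (hp.isWhite hM) θ) k
  rw [one_mul] at h
  exact ⟨_, h.l2, h.mom_eq⟩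

theorem hasMom_errResp (θ : Param np ny n) (t : ℤ) (k : ℕ) :
    HasMom μ p (t - k) (fun ω => errResp θ (schedVec (traj p ω)) t k)
      (outMom ny n μ (sched₀ p) * trans μ (sched₀ p) θ ^ k) := by
  have h1 := hp.hasMom (measurable_lin_apply (outMat ny n))
    ((hp.isWhite hM).l2Mat_lin (outMat ny n)) t
  have h2 : t = t - 1 + 1 := by ring
  rw [h2] at h1
  have h3 := h1.mul_prodFrom hp (measurable_errMat_apply θ) (l2Mat_errMat (hp.isWhite hM) θ) k
  rw [← h2] at h3
  exact h3

theorem hasMom_errResp_mul (θ v : Param np ny n) (t : ℤ) (k : ℕ) :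
    HasMom μ p (t - 1 - k) (fun ω => errResp θ (schedVec (traj p ω)) t k
        * lin (gainMat v) (schedVec (traj p ω) (t - 1 - k)))
      (outMom ny n μ (sched₀ p) * trans μ (sched₀ p) θ ^ k * gainMom μ (sched₀ p) v) := by
  have h1 := hasMom_errResp hp hM θ t k
  have h2 : t - (k : ℤ) = t - 1 - k + 1 := by ring
  rw [h2] at h1
  exact h1.mul hp (measurable_lin_apply (gainMat v)) ((hp.isWhite hM).l2Mat_lin (gainMat v))

theorem hasMom_invCoeff_succ (θ : Param np ny n) (t : ℤ) (k : ℕ) :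
    HasMom μ p (t - 1 - k) (fun ω => invCoeff θ (traj p ω) t (k + 1))
      (outMom ny n μ (sched₀ p) * trans μ (sched₀ p) θ ^ k * gainMom μ (sched₀ p) θ) := by
  simp only [invCoeff_succ]
  exact (hasMom_errResp_mul hp hM θ θ t k).neg

theorem hasMom_coeff_succ (h : Param np ny n) (t : ℤ) (j : ℕ) :
    HasMom μ p (t - 1 - j) (fun ω => coeff h (traj p ω) t (j + 1))
      (outMom ny n μ (sched₀ p) * mom μ (fun ω => lin (shiftMat ny n) (sched₀ p ω)) ^ j
        * gainMom μ (sched₀ p) h) := by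
  have h1 := hp.hasMom (measurable_lin_apply (outMat ny n))
    ((hp.isWhite hM).l2Mat_lin (outMat ny n)) t
  have h2 : t = t - 1 + 1 := by ring
  rw [h2] at h1
  have h3 := h1.mul_prodFrom hp (measurable_lin_apply (shiftMat ny n))
    ((hp.isWhite hM).l2Mat_lin (shiftMat ny n)) j
  rw [← h2] at h3
  have h4 : t - (j : ℤ) = t - 1 - j + 1 := by ring
  rw [h4] at h3
  have h5 := h3.mul hp (measurable_lin_apply (gainMat h)) ((hp.isWhite hM).l2Mat_lin (gainMat h))
  simp only [coeff_succ]
  exact h5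

/-- The last gain of `Γ_{i+1}(t)` and the output matrix of `C_{j+1}(t - i - 1)` refer to the same
time and are not independent, so their product is handled as one factor. -/
theorem hasMom_invCoeff_mul_coeff (θ h : Param np ny n) (t : ℤ) (i j : ℕ) :
    HasMom μ p (t - 1 - i - 1 - j)
      (fun ω => invCoeff θ (traj p ω) t (i + 1)
        * coeff h (traj p ω) (t - ((i + 1 : ℕ) : ℤ)) (j + 1))
      (outMom ny n μ (sched₀ p) * trans μ (sched₀ p) θ ^ i
        * (mom μ (fun ω => lin (gainMat θ) (sched₀ p ω) * lin (outMat ny n) (sched₀ p ω))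
          * mom μ (fun ω => lin (shiftMat ny n) (sched₀ p ω)) ^ j * gainMom μ (sched₀ p) h)) := by
  have h1 := hasMom_errResp hp hM θ t i
  have h2 : t - (i : ℤ) = t - 1 - i + 1 := by ring
  rw [h2] at h1
  have h3 := h1.mul hp (measurable_lin_mul_lin_apply (gainMat θ) (outMat ny n))
    ((hp.isWhite hM).l2Mat_lin_mul_lin (gainMat θ) (outMat ny n))
  have h4 : t - 1 - (i : ℤ) = t - 1 - i - 1 + 1 := by ring
  rw [h4] at h3
  have h5 := h3.mul_prodFrom hp (measurable_lin_apply (shiftMat ny n))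
    ((hp.isWhite hM).l2Mat_lin (shiftMat ny n)) j
  have h6 : t - 1 - (i : ℤ) - 1 + 1 - j = t - 1 - i - 1 - j + 1 := by ring
  rw [h6] at h5
  have h7 := (h5.mul hp (measurable_lin_apply (gainMat h))
    ((hp.isWhite hM).l2Mat_lin (gainMat h))).neg
  rw [← h4] at h7
  have h8 : t - ((i + 1 : ℕ) : ℤ) = t - 1 - i := by push_cast; ring
  simp only [invCoeff_succ, coeff_succ, h8]
  simp only [Matrix.neg_mul, Matrix.mul_assoc] at h7 ⊢
  exact h7

end FilterMoments

end LPVMA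

namespace LPVMA

/-! ### Stability of the inverse filter in terms of second moments -/

theorem StableMat.exists_abs_mul_pow_mul_le {κ ι ν : Type*} [Finite κ] [Finite ν] [Fintype ι]
    [DecidableEq ι] {T : Matrix ι ι ℝ} (hT : StableMat T) (A : Matrix κ ι ℝ) (B : Matrix ι ν ℝ) :
    ∃ C r : ℝ, 0 ≤ C ∧ 0 ≤ r ∧ r < 1 ∧ ∀ k x y, |(A * T ^ k * B) x y| ≤ C * r ^ k := by
  have := Fintype.ofFinite κ
  have := Fintype.ofFinite ν
  obtain ⟨C, r, hC, hr0, hr1, h⟩ := hT.exists_abs_pow_le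
  have h0 : ∀ x y, 0 ≤ ∑ j, ∑ i, |A x i| * |B j y| := fun x y =>
    Finset.sum_nonneg fun j _ => Finset.sum_nonneg fun i _ => by positivity
  refine ⟨∑ x, ∑ y, (∑ j, ∑ i, |A x i| * |B j y|) * C, r, ?_, hr0, hr1, fun k x y => ?_⟩
  · exact Finset.sum_nonneg fun x _ => Finset.sum_nonneg fun y _ => mul_nonneg (h0 x y) hC
  calc |(A * T ^ k * B) x y| ≤ ∑ j, ∑ i, |A x i| * |B j y| * (C * r ^ k) := by
        rw [Matrix.mul_apply]
        refine (Finset.abs_sum_le_sum_abs _ _).trans (Finset.sum_le_sum fun j _ => ?_)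
        rw [Matrix.mul_apply, abs_mul, ← Finset.sum_mul] 
        calc |∑ i, A x i * (T ^ k) i j| * |B j y|
            ≤ (∑ i, |A x i| * (C * r ^ k)) * |B j y| := by
              gcongr
              refine (Finset.abs_sum_le_sum_abs _ _).trans (Finset.sum_le_sum fun i _ => ?_)
              rw [abs_mul]
              gcongr
              exact h k i j
          _ = _ := by rw [← Finset.sum_mul, ← Finset.sum_mul]; ring
    _ = (∑ j, ∑ i, |A x i| * |B j y|) * C * r ^ k := by
        simp only [Finset.sum_mul, mul_assoc]
    _ ≤ _ := by
        gcongr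
        refine (Finset.single_le_sum (f := fun y => (∑ j, ∑ i, |A x i| * |B j y|) * C)
          (fun y _ => mul_nonneg (h0 x y) hC) (Finset.mem_univ y)).trans ?_
        exact Finset.single_le_sum (f := fun x => ∑ y, (∑ j, ∑ i, |A x i| * |B j y|) * C)
          (fun x _ => Finset.sum_nonneg fun y _ => mul_nonneg (h0 x y) hC) (Finset.mem_univ x)

section Stability

variable {Ω : Type*} [MeasurableSpace Ω] {μ : Measure Ω} [IsProbabilityMeasure μ] {np ny n M : ℕ}
  {p : Fin np → ℤ → Ω → ℝ} {e : ℤ → Ω → Fin ny → ℝ}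

variable (hp : IsSchedulingNoise μ p e M) (hM : 4 ≤ M)

include hp hM

theorem integral_sum_invCoeff_sq (θ : Param np ny n) (t : ℤ) (k : ℕ) :
    ∫ ω, ∑ a : Fin ny, ∑ b : Fin ny, (invCoeff θ (traj p ω) t (k + 1) a b) ^ 2 ∂μ
      = ∑ a, ((outMom ny n μ (sched₀ p) * trans μ (sched₀ p) θ ^ k
          * gainMom μ (sched₀ p) θ).mulVec (vecOne (Fin ny))) (a, a) := by
  have h := hasMom_invCoeff_succ hp hM θ t k
  have hi : ∀ a b, Integrable (fun ω => (invCoeff θ (traj p ω) t (k + 1) a b) ^ 2) μ :=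
    fun a b => (h.l2 a b).integrable_sq
  rw [← h.mom_eq, integral_finsetSum _ fun a _ => integrable_finsetSum _ fun b _ => hi a b]
  refine Finset.sum_congr rfl fun a _ => ?_
  rw [integral_finsetSum _ fun b _ => hi a b]
  simp [Matrix.mulVec, dotProduct, Fintype.sum_prod_type, vecOne, mom_apply, sq]

/-- The moments do not depend on `t`, so `t = 0` suffices in one direction; conversely stability
gives geometric decay. The index shift discards `Γ_0 = I`. -/
theorem mem_stableSet_iff (θ : Param np ny n) :
    θ ∈ stableSet ny n μ p ↔ StableMat (trans μ (sched₀ p) θ) := by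
  constructor
  · intro hθ
    have h1 := (summable_nat_add_iff 1).mpr (hθ 0)
    simp only [integral_sum_invCoeff_sq hp hM] at h1
    exact tendsto_pi_nhds.mpr fun x => tendsto_pi_nhds.mpr fun y =>
      tendsto_trans_pow (hp.isWhite hM) θ (exists_mom_eq_trans_pow hp hM θ) h1 x y
  · intro hθ t
    refine (summable_nat_add_iff 1).mp ?_
    simp only [integral_sum_invCoeff_sq hp hM]
    obtain ⟨C, r, -, hr0, hr1, hC⟩ := hθ.exists_abs_mul_pow_mul_le (outMom ny n μ (sched₀ p))
      (gainMom μ (sched₀ p) θ)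
    refine summable_sum fun a _ => summable_sum fun x _ => Summable.mul_right _ ?_
    exact Summable.of_norm_bounded ((summable_geometric_of_lt_one hr0 hr1).mul_left C)
      fun k => hC k (a, a) x

end Stability

/-! ### The noise -/

section Noise

variable {Ω : Type*} [MeasurableSpace Ω] {μ : Measure Ω} {np ny M : ℕ}
  {p : Fin np → ℤ → Ω → ℝ} {e : ℤ → Ω → Fin ny → ℝ} {S : Matrix (Fin ny) (Fin ny) ℝ}

theorem IsGaussianNoise.memLp (he : IsGaussianNoise μ e S) (s : ℤ) (b : Fin ny) :
    MemLp (fun ω => e s ω b) 2 μ :=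
  (he.gaussian s).memLp_two.eval b

theorem IsGaussianNoise.integral_mul (he : IsGaussianNoise μ e S) (s s' : ℤ) (b c : Fin ny) :
    ∫ ω, e s ω b * e s' ω c ∂μ = if s = s' then S b c else 0 := by
  split_ifs with h
  · subst h
    exact he.cov s b c
  · have h1 := (he.indep.indepFun h).comp (measurable_pi_apply b) (measurable_pi_apply c)
    have h2 := h1.integral_fun_mul_eq_mul_integral (he.memLp s b).aestronglyMeasurable
      (he.memLp s' c).aestronglyMeasurable
    exact h2.trans (by simp [he.mean])

/-- The `σ`-algebra of the noise. -/
@[reducible] def noiseAlg (e : ℤ → Ω → Fin ny → ℝ) : MeasurableSpace Ω :=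
  MeasurableSpace.comap (fun ω t => e t ω) inferInstance

omit [MeasurableSpace Ω] in
theorem measurable_noiseAlg (s : ℤ) (b : Fin ny) : Measurable[noiseAlg e] fun ω => e s ω b := by
  have h : Measurable fun f : ℤ → Fin ny → ℝ => f s b := by fun_prop
  exact h.comp (comap_measurable fun ω t => e t ω)

theorem IsSchedulingNoise.indep_noiseAlg (hp : IsSchedulingNoise μ p e M) (s : Set ℤ) :
    Indep (schedAlg p s) (noiseAlg e) μ :=
  indep_of_indep_of_le_left ((IndepFun_iff_Indep _ _ _).mp hp.indep_noise) (schedAlg_le_comap s)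

variable {κ : Type*} {W W' : Ω → Matrix κ (Fin ny) ℝ} {r : ℤ}

theorem memLp_mulVec_noise (hp : IsSchedulingNoise μ p e M) (he : IsGaussianNoise μ e S)
    (hW : ∀ i j, Measurable[schedAlg p (Set.Ici r)] fun ω => W ω i j) (hW2 : L2Mat μ W) (s : ℤ)
    (a : κ) : MemLp (fun ω => (W ω).mulVec (e s ω) a) 2 μ := by
  simp only [Matrix.mulVec, dotProduct]
  exact memLp_finsetSum _ fun b _ => memLp_two_mul_of_indep (hp.indep_noiseAlg _) (hW a b)
    (measurable_noiseAlg s b) (hW2 a b) (he.memLp s b)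

theorem integral_mulVec_noise_mul (hp : IsSchedulingNoise μ p e M) (he : IsGaussianNoise μ e S)
    {r' : ℤ} (hW : ∀ i j, Measurable[schedAlg p (Set.Ici r)] fun ω => W ω i j) (hW2 : L2Mat μ W)
    (hW' : ∀ i j, Measurable[schedAlg p (Set.Ici r')] fun ω => W' ω i j) (hW2' : L2Mat μ W')
    (s s' : ℤ) (a a' : κ) :
    ∫ ω, (W ω).mulVec (e s ω) a * (W' ω).mulVec (e s' ω) a' ∂μ
      = ∑ b, ∑ c, (∫ ω, W ω a b * W' ω a' c ∂μ) * if s = s' then S b c else 0 := by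
  -- The minimum places both matrices in one scheduling `σ`-algebra, independent of the noise.
  have hind := hp.indep_noiseAlg (Set.Ici (min r r'))
  have hm : ∀ b, Measurable[schedAlg p (Set.Ici (min r r'))] fun ω => W ω a b := fun b =>
    (hW a b).mono (schedAlg_mono (Set.Ici_subset_Ici.mpr (min_le_left r r'))) le_rfl
  have hm' : ∀ c, Measurable[schedAlg p (Set.Ici (min r r'))] fun ω => W' ω a' c := fun c =>
    (hW' a' c).mono (schedAlg_mono (Set.Ici_subset_Ici.mpr (min_le_right r r'))) le_rfl
  have hI : ∀ b c, IndepFun (fun ω => W ω a b * W' ω a' c) (fun ω => e s ω b * e s' ω c) μ :=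
    fun b c => indepFun_of_indep hind ((hm b).mul (hm' c))
      ((measurable_noiseAlg s b).mul (measurable_noiseAlg s' c))
  have hi1 : ∀ b c, Integrable (fun ω => W ω a b * W' ω a' c) μ :=
    fun b c => (hW2 _ _).integrable_mul (hW2' _ _)
  have hi2 : ∀ b c, Integrable (fun ω => e s ω b * e s' ω c) μ :=
    fun b c => (he.memLp _ _).integrable_mul (he.memLp _ _)
  have hi3 : ∀ b c, Integrable (fun ω => W ω a b * e s ω b * (W' ω a' c * e s' ω c)) μ := by
    intro b c
    refine ((hI b c).integrable_mul (hi1 b c) (hi2 b c)).congr (ae_of_all _ fun ω => ?_)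
    simp only [Pi.mul_apply]
    ring
  simp only [Matrix.mulVec, dotProduct, Finset.sum_mul_sum]
  rw [integral_finsetSum _ fun b _ => integrable_finsetSum _ fun c _ => hi3 b c]
  refine Finset.sum_congr rfl fun b _ => ?_
  rw [integral_finsetSum _ fun c _ => hi3 b c]
  refine Finset.sum_congr rfl fun c _ => ?_
  rw [← he.integral_mul, ← (hI b c).integral_fun_mul_eq_mul_integral
    (hi1 b c).aestronglyMeasurable (hi2 b c).aestronglyMeasurable]
  exact integral_congr_ae (ae_of_all _ fun ω => mul_mul_mul_comm _ _ _ _)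

theorem integral_mulVec_noise_sq (hp : IsSchedulingNoise μ p e M) (he : IsGaussianNoise μ e S)
    {X : Matrix (κ × κ) (Fin ny × Fin ny) ℝ} (hW : HasMom μ p r W X) (s : ℤ) (a : κ) :
    ∫ ω, (W ω).mulVec (e s ω) a ^ 2 ∂μ = X.mulVec (vecMat S) (a, a) := by
  simp only [sq]
  rw [integral_mulVec_noise_mul hp he hW.meas hW.l2 hW.meas hW.l2, ← hW.mom_eq]
  simp [Matrix.mulVec, dotProduct, Fintype.sum_prod_type, vecMat, mom_apply]

end Noise

end LPVMA

namespace LPVMA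

/-! ### Series in `L²` -/

section SquareIntegrableSeries

variable {Ω : Type*} [MeasurableSpace Ω] {μ : Measure Ω}

theorem inner_toLp_toLp {f g : Ω → ℝ} (hf : MemLp f 2 μ) (hg : MemLp g 2 μ) :
    inner ℝ (hf.toLp f) (hg.toLp g) = ∫ ω, f ω * g ω ∂μ := by
  rw [L2.inner_def]
  refine integral_congr_ae ?_
  filter_upwards [hf.coeFn_toLp, hg.coeFn_toLp] with ω h1 h2
  rw [h1, h2]
  simp [mul_comm]

theorem norm_toLp_two {f : Ω → ℝ} (hf : MemLp f 2 μ) :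
    ‖hf.toLp f‖ = √(∫ ω, f ω ^ 2 ∂μ) := by
  rw [norm_eq_sqrt_real_inner, inner_toLp_toLp]
  simp only [sq]

theorem exists_hasSum_toLp {ι : Type*} [Countable ι] {f : ι → Ω → ℝ} (hf : ∀ i, MemLp (f i) 2 μ)
    (hs : Summable fun i => √(∫ ω, f i ω ^ 2 ∂μ)) :
    ∃ F : Lp ℝ 2 μ, HasSum (fun i => (hf i).toLp (f i)) F
      ∧ ∀ᵐ ω ∂μ, HasSum (fun i => f i ω) (F ω) := by
  simp only [← fun i => norm_toLp_two (hf i)] at hs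
  refine ⟨_, hs.of_norm.hasSum, ?_⟩
  have h1 : ∑' i, ‖(hf i).toLp (f i)‖ₑ ≠ ⊤ := tsum_enorm_ne_top_iff_summable_norm.mpr hs
  filter_upwards [Lp.hasSum_coeFn_tsum h1, ae_all_iff.mpr fun i => (hf i).coeFn_toLp] with ω h2 h3
  simpa only [h3] using h2

/-- Pythagoras: the inner product of `F` with each term is the squared norm of that term, and
summing these gives `⟨F, F⟩`. -/
theorem hasSum_integral_sq {z : ℕ → Ω → ℝ} (hz : ∀ k, MemLp (z k) 2 μ)
    (horth : ∀ k l, k ≠ l → ∫ ω, z k ω * z l ω ∂μ = 0) {F : Lp ℝ 2 μ}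
    (hF : HasSum (fun k => (hz k).toLp (z k)) F) :
    HasSum (fun k => ∫ ω, z k ω ^ 2 ∂μ) (∫ ω, F ω ^ 2 ∂μ) := by
  have h1 : ∫ ω, F ω ^ 2 ∂μ = inner ℝ F F := by
    rw [L2.inner_def]
    simp [sq]
  have h2 : ∀ k, inner ℝ F ((hz k).toLp (z k)) = ∫ ω, z k ω ^ 2 ∂μ := by
    intro k
    rw [real_inner_comm]
    have h3 := hF.mapL (innerSL ℝ ((hz k).toLp (z k)))
    refine h3.unique ?_
    have h4 : ∀ l, innerSL ℝ ((hz k).toLp (z k)) ((hz l).toLp (z l)) = ∫ ω, z k ω * z l ω ∂μ :=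
      fun l => inner_toLp_toLp (hz k) (hz l)
    simp only [h4, sq]
    exact hasSum_single k fun l hl => horth k l hl.symm
  have h3 : HasSum (fun k => inner ℝ F ((hz k).toLp (z k))) (inner ℝ F F) :=
    hF.mapL (innerSL ℝ F)
  simpa only [h2, h1] using h3

theorem toLp_finset_sum {ι : Type*} [Countable ι] (s : Finset ι) {f : ι → Ω → ℝ} (hf : ∀ i, MemLp (f i) 2 μ)
    {g : Ω → ℝ} (hg : MemLp g 2 μ) (hfg : ∀ ω, g ω = ∑ i ∈ s, f i ω) :
    hg.toLp g = ∑ i ∈ s, (hf i).toLp (f i) := by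
  refine Lp.ext ?_
  filter_upwards [hg.coeFn_toLp, ae_all_iff.mpr fun i => (hf i).coeFn_toLp,
    Lp.coeFn_fun_finsetSum (p := 2) (μ := μ) s fun i => (hf i).toLp (f i)] with ω h1 h2 h3
  rw [h1, h3, hfg]
  simp only [h2]

theorem hasSum_antidiagonal_toLp {f : ℕ × ℕ → Ω → ℝ} (hf : ∀ x, MemLp (f x) 2 μ) {F : Lp ℝ 2 μ}
    (hF : HasSum (fun x => (hf x).toLp (f x)) F) {z : ℕ → Ω → ℝ} (hz : ∀ k, MemLp (z k) 2 μ)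
    (hzf : ∀ k ω, z k ω = ∑ x ∈ Finset.HasAntidiagonal.antidiagonal k, f x ω) :
    HasSum (fun k => (hz k).toLp (z k)) F := by
  have h1 := (Finset.HasAntidiagonal.sigmaAntidiagonalEquivProd (A := ℕ)).hasSum_iff.mpr hF
  refine (h1.sigma fun k => ?_)
  rw [toLp_finset_sum _ hf (hz k) (hzf k)]
  exact (Finset.HasAntidiagonal.antidiagonal k).hasSum fun x => (hf x).toLp (f x)

end SquareIntegrableSeries

end LPVMA

namespace LPVMA

/-! ### The prediction error -/

section Extension

variable {Ω : Type*} {np ny n m k : ℕ}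

theorem coeff_eq_zero (h : Param np ny n) (p : Fin np → ℤ → ℝ) (t : ℤ) {j : ℕ} (hj : n < j) :
    coeff h p t j = 0 := by
  obtain ⟨j, rfl⟩ := Nat.exists_eq_succ_of_ne_zero (Nat.ne_zero_of_lt hj)
  rw [coeff, dif_neg (by omega)]

theorem output_extend (hm : n ≤ m) (h : Param np ny n) (p : Fin np → ℤ → Ω → ℝ)
    (e : ℤ → Ω → Fin ny → ℝ) : output (extend m h) p e = output h p e := by
  funext t ω
  simp only [output, coeff_extend hm]
  symm
  refine Finset.sum_subset (Finset.range_subset_range.mpr (by omega)) fun j _ hj => ?_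
  rw [coeff_eq_zero h _ _ (by simpa using hj), Matrix.zero_mulVec]

theorem predError_extend (hm : n ≤ m) (h : Param np ny n) (p : Fin np → ℤ → Ω → ℝ)
    (e : ℤ → Ω → Fin ny → ℝ) (θ : Param np ny k) :
    predError (extend m h) p e θ = predError h p e θ := by
  funext t ω
  simp only [predError, output_extend hm]

end Extension

section PredictionError

variable {Ω : Type*} [MeasurableSpace Ω] {μ : Measure Ω} [IsProbabilityMeasure μ] {np ny n M : ℕ}
  {p : Fin np → ℤ → Ω → ℝ} {e : ℤ → Ω → Fin ny → ℝ} {S : Matrix (Fin ny) (Fin ny) ℝ}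

/-- The matrix coefficient of `e(t - i - j)` in `Γ_i(t) C_j(t - i) e(t - i - j)`. -/
def termMat (θ h : Param np ny n) (p : Fin np → ℤ → Ω → ℝ) (t : ℤ) (x : ℕ × ℕ) (ω : Ω) :
    Matrix (Fin ny) (Fin ny) ℝ :=
  invCoeff θ (traj p ω) t x.1 * coeff h (traj p ω) (t - (x.1 : ℤ)) x.2

/-- The response of the prediction error at time `t` to `e(t - k)`. -/
def respMat (θ h : Param np ny n) (p : Fin np → ℤ → Ω → ℝ) (t : ℤ) (k : ℕ) (ω : Ω) :
    Matrix (Fin ny) (Fin ny) ℝ :=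
  ∑ x ∈ Finset.HasAntidiagonal.antidiagonal k, termMat θ h p t x ω

/-- The second moment of `respMat`. -/
noncomputable def respMom (μ : Measure Ω) (w : Ω → Fin (np + 1) → ℝ) (θ h : Param np ny n) :
    ℕ → Matrix (Fin ny × Fin ny) (Fin ny × Fin ny) ℝ
  | 0 => 1
  | k + 1 => outMom ny n μ w * trans μ w θ ^ k * gainMom μ w (h - θ)

omit [MeasurableSpace Ω] in
theorem respMat_zero (θ h : Param np ny n) (p : Fin np → ℤ → Ω → ℝ) (t : ℤ) (ω : Ω) :
    respMat θ h p t 0 ω = 1 := by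
  simp [respMat, termMat, invCoeff, coeff]

omit [MeasurableSpace Ω] in
theorem respMat_succ (θ h : Param np ny n) (p : Fin np → ℤ → Ω → ℝ) (t : ℤ) (k : ℕ) (ω : Ω) :
    respMat θ h p t (k + 1) ω = errResp θ (schedVec (traj p ω)) t k
        * lin (gainMat (h - θ)) (schedVec (traj p ω) (t - 1 - k)) := by
  rw [← sum_invCoeff_mul_coeff, respMat, Finset.Nat.sum_antidiagonal_eq_sum_range_succ_mk]
  rfl

omit [IsProbabilityMeasure μ] in
theorem hasSum_respMom (θ h : Param np ny n) (hθ : StableMat (trans μ (sched₀ p) θ)) :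
    HasSum (fun k => ∑ a, (respMom μ (sched₀ p) θ h k).mulVec (vecMat S) (a, a))
      (momLoss μ (sched₀ p) S h θ) := by
  have h1 : HasSum (fun k => dotProduct (costate μ (sched₀ p) θ k)
      ((gainMom μ (sched₀ p) (h - θ)).mulVec (vecMat S)))
      (dotProduct (costateSum μ (sched₀ p) θ)
        ((gainMom μ (sched₀ p) (h - θ)).mulVec (vecMat S))) :=
    hasSum_sum fun x _ => (Pi.hasSum.mp (hasSum_costate hθ) x).mul_right _
  have h2 : ∀ k, ∑ a, (respMom μ (sched₀ p) θ h (k + 1)).mulVec (vecMat S) (a, a)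
      = dotProduct (costate μ (sched₀ p) θ k)
        ((gainMom μ (sched₀ p) (h - θ)).mulVec (vecMat S)) := by
    intro k
    rw [respMom, costate, ← Matrix.dotProduct_mulVec, Matrix.mulVec_mulVec]
    simp [dotProduct, vecOne, Fintype.sum_prod_type]
  have h3 : ∑ a, (respMom μ (sched₀ p) θ h 0).mulVec (vecMat S) (a, a) = S.trace := by
    simp [respMom, vecMat, Matrix.trace]
  rw [momLoss, ← h3, add_comm]
  refine (hasSum_nat_add_iff (f := fun k => ∑ a, (respMom μ (sched₀ p) θ h k).mulVec
    (vecMat S) (a, a)) 1).mp ?_ |> fun h => by simpa using h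
  simpa only [h2] using h1

section Moments

variable (hp : IsSchedulingNoise μ p e M) (hM : 4 ≤ M)

include hp hM

theorem hasMom_respMat (θ h : Param np ny n) (t : ℤ) (k : ℕ) :
    HasMom μ p (t - k) (respMat θ h p t k) (respMom μ (sched₀ p) θ h k) := by
  cases k with
  | zero =>
    have h1 : respMat θ h p t 0 = fun _ => 1 := funext fun ω => respMat_zero θ h p t ω
    rw [h1]
    exact hasMom_one _
  | succ k =>
    have h1 := hasMom_errResp_mul hp hM θ (h - θ) t k
    simp only [← respMat_succ] at h1
    have h2 : t - ((k + 1 : ℕ) : ℤ) = t - 1 - k := by push_cast; ring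
    rw [h2]
    exact h1

theorem exists_hasMom_termMat (θ h : Param np ny n) (t : ℤ) (x : ℕ × ℕ) :
    ∃ r X, HasMom μ p r (termMat θ h p t x) X := by
  obtain ⟨i, j⟩ := x
  unfold termMat
  cases i with
  | zero =>
    simp only [invCoeff, one_mul]
    cases j with
    | zero =>
      simp only [coeff]
      exact ⟨0, _, hasMom_one 0⟩
    | succ j => exact ⟨_, _, hasMom_coeff_succ hp hM h _ j⟩
  | succ i =>
    cases j with
    | zero =>
      simp only [coeff, mul_one]
      exact ⟨_, _, hasMom_invCoeff_succ hp hM θ t i⟩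
    | succ j => exact ⟨_, _, hasMom_invCoeff_mul_coeff hp hM θ h t i j⟩

/-- For fixed `j` the dependence on `i` is confined to the power of the transition matrix, which
gives geometric decay in `i`. -/
theorem exists_hasMom_termMat_succ (θ h : Param np ny n) (t : ℤ) (j : ℕ) :
    ∃ B : Matrix (StateIdx np ny n × StateIdx np ny n) (Fin ny × Fin ny) ℝ, ∀ i, ∃ r,
      HasMom μ p r (termMat θ h p t (i + 1, j))
        (outMom ny n μ (sched₀ p) * trans μ (sched₀ p) θ ^ i * B) := by
  unfold termMat
  cases j with
  | zero =>
    simp only [coeff, mul_one]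
    exact ⟨_, fun i => ⟨_, hasMom_invCoeff_succ hp hM θ t i⟩⟩
  | succ j => exact ⟨_, fun i => ⟨_, hasMom_invCoeff_mul_coeff hp hM θ h t i j⟩⟩

variable (he : IsGaussianNoise μ e S)

include he

theorem memLp_termMat (θ h : Param np ny n) (t : ℤ) (a : Fin ny) (x : ℕ × ℕ) :
    MemLp (fun ω => (termMat θ h p t x ω).mulVec (e (t - x.1 - x.2) ω) a) 2 μ := by
  obtain ⟨r, X, hX⟩ := exists_hasMom_termMat hp hM θ h t x
  exact memLp_mulVec_noise hp he hX.meas hX.l2 _ a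

theorem memLp_respMat (θ h : Param np ny n) (t : ℤ) (a : Fin ny) (k : ℕ) :
    MemLp (fun ω => (respMat θ h p t k ω).mulVec (e (t - k) ω) a) 2 μ :=
  memLp_mulVec_noise hp he (hasMom_respMat hp hM θ h t k).meas (hasMom_respMat hp hM θ h t k).l2 _ a

/-- The `L²` norms decay like `√r ^ i` for each `j`, and only the finitely many `j ≤ n` contribute.
-/
theorem summable_termMat {θ : Param np ny n} (hθ : StableMat (trans μ (sched₀ p) θ))
    (h : Param np ny n) (t : ℤ) (a : Fin ny) :
    Summable fun x : ℕ × ℕ =>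
      √(∫ ω, (termMat θ h p t x ω).mulVec (e (t - x.1 - x.2) ω) a ^ 2 ∂μ) := by
  have hcol : ∀ j, Summable fun i : ℕ =>
      √(∫ ω, (termMat θ h p t (i, j) ω).mulVec (e (t - i - j) ω) a ^ 2 ∂μ) := by
    intro j
    refine (summable_nat_add_iff 1).mp ?_
    obtain ⟨B, hB⟩ := exists_hasMom_termMat_succ hp hM θ h t j
    obtain ⟨C, r, hC0, hr0, hr1, hC⟩ := hθ.exists_abs_mul_pow_mul_le (outMom ny n μ (sched₀ p)) B
    have hs : Summable fun i : ℕ => √(C * ∑ y, |vecMat S y|) * √r ^ i :=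
      (summable_geometric_of_lt_one (Real.sqrt_nonneg r)
        (by rwa [Real.sqrt_lt' one_pos, one_pow])).mul_left _
    refine Summable.of_nonneg_of_le (fun i => Real.sqrt_nonneg _) (fun i => ?_) hs
    obtain ⟨s, hs⟩ := hB i
    rw [integral_mulVec_noise_sq hp he hs]
    refine Real.sqrt_le_iff.mpr ⟨by positivity, ?_⟩
    have h1 : 0 ≤ C * ∑ y, |vecMat S y| :=
      mul_nonneg hC0 (Finset.sum_nonneg fun y _ => abs_nonneg _)
    rw [mul_pow, Real.sq_sqrt h1, ← pow_mul, mul_comm i 2, pow_mul, Real.sq_sqrt hr0]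
    refine (le_abs_self _).trans ?_
    simp only [Matrix.mulVec, dotProduct]
    calc |∑ y, (outMom ny n μ (sched₀ p) * trans μ (sched₀ p) θ ^ i * B) (a, a) y * vecMat S y|
        ≤ ∑ y, C * r ^ i * |vecMat S y| := by
          refine (Finset.abs_sum_le_sum_abs _ _).trans (Finset.sum_le_sum fun y _ => ?_)
          rw [abs_mul]
          exact mul_le_mul_of_nonneg_right (hC i _ y) (abs_nonneg _)
      _ = _ := by rw [← Finset.mul_sum]; ring
  have hzero : ∀ i j, n < j →
      √(∫ ω, (termMat θ h p t (i, j) ω).mulVec (e (t - i - j) ω) a ^ 2 ∂μ) = 0 := by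
    intro i j hj
    simp [termMat, coeff_eq_zero h _ _ hj]
  rw [← (Equiv.prodComm ℕ ℕ).summable_iff]
  refine (summable_prod_of_nonneg fun x => Real.sqrt_nonneg _).mpr ⟨hcol, ?_⟩
  refine summable_of_ne_finset_zero (s := Finset.range (n + 1)) fun j hj => ?_
  have hj' : n < j := by simpa using hj
  exact (tsum_congr fun i => hzero i j hj').trans tsum_zero

/-- The absolutely convergent double series of `Γ_i C_j e(t - i - j)` is summed in two ways: over
`j` first it is the series of `ε`; along `i + j = k` its terms are orthogonal, since different `k`
involve noise at different times. -/
theorem exists_predError {θ : Param np ny n} (hθ : StableMat (trans μ (sched₀ p) θ))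
    (h : Param np ny n) (t : ℤ) (a : Fin ny) :
    ∃ F : Lp ℝ 2 μ,
      (∀ᵐ ω ∂μ, HasSum (fun i : ℕ => (invCoeff θ (traj p ω) t i).mulVec
        (output h p e (t - (i : ℤ)) ω) a) (F ω)) ∧
      HasSum (fun k => (respMom μ (sched₀ p) θ h k).mulVec (vecMat S) (a, a))
        (∫ ω, F ω ^ 2 ∂μ) := by
  obtain ⟨F, hF, hFae⟩ := exists_hasSum_toLp (memLp_termMat hp hM he θ h t a)
    (summable_termMat hp hM he hθ h t a)
  refine ⟨F, ?_, ?_⟩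
  · filter_upwards [hFae] with ω hω
    refine hω.prod_fiberwise fun i => ?_
    have h1 : (invCoeff θ (traj p ω) t i).mulVec (output h p e (t - (i : ℤ)) ω) a
        = ∑ j ∈ Finset.range (n + 1),
          (termMat θ h p t (i, j) ω).mulVec (e (t - i - j) ω) a := by
      rw [output, Matrix.mulVec_sum, Finset.sum_apply]
      simp only [Matrix.mulVec_mulVec, termMat]
    rw [h1]
    refine hasSum_sum_of_ne_finset_zero fun j hj => ?_
    have hj' : n < j := by simpa using hj
    simp [termMat, coeff_eq_zero h _ _ hj']
  · have h1 := hasSum_antidiagonal_toLp _ hF (memLp_respMat hp hM he θ h t a) fun k ω => by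
      rw [respMat, Matrix.sum_mulVec, Finset.sum_apply]
      refine Finset.sum_congr rfl fun x hx => ?_
      have ht : t - (k : ℤ) = t - x.1 - x.2 := by
        rw [← Finset.HasAntidiagonal.mem_antidiagonal.mp hx]
        push_cast
        ring
      rw [ht]
    have h2 := hasSum_integral_sq _ (fun k l hkl => ?_) h1
    · simpa only [integral_mulVec_noise_sq hp he (hasMom_respMat hp hM θ h t _)] using h2
    · have hk := hasMom_respMat hp hM θ h t k
      have hl := hasMom_respMat hp hM θ h t l
      rw [integral_mulVec_noise_mul hp he hk.meas hk.l2 hl.meas hl.l2]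
      simp [hkl]

/-- The series of the prediction error converges, and its second moment is `momLoss`. -/
theorem predError_spec {θ : Param np ny n} (hθ : StableMat (trans μ (sched₀ p) θ))
    (h : Param np ny n) (t : ℤ) :
    (∀ᵐ ω ∂μ, Summable fun i : ℕ =>
      (invCoeff θ (traj p ω) t i).mulVec (output h p e (t - (i : ℤ)) ω)) ∧
    MemLp (predError h p e θ t) 2 μ ∧
    ∑ a, ∫ ω, predError h p e θ t ω a * predError h p e θ t ω a ∂μ
      = momLoss μ (sched₀ p) S h θ := by
  choose F hF hF2 using exists_predError hp hM he hθ h t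
  have h1 := ae_all_iff.mpr hF
  have h2 : ∀ᵐ ω ∂μ, ∀ a, F a ω = predError h p e θ t ω a := by
    filter_upwards [h1] with ω hω a
    exact congrFun (Pi.hasSum.mpr hω).tsum_eq.symm a
  refine ⟨?_, ?_, ?_⟩
  · filter_upwards [h1] with ω hω
    exact (Pi.hasSum.mpr hω).summable
  · refine memLp_pi_iff.mpr fun a => (Lp.memLp (F a)).ae_eq ?_
    filter_upwards [h2] with ω hω using hω a
  · have h3 : ∀ a, ∫ ω, predError h p e θ t ω a * predError h p e θ t ω a ∂μ
        = ∫ ω, F a ω ^ 2 ∂μ := fun a => by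
      refine integral_congr_ae ?_
      filter_upwards [h2] with ω hω
      rw [hω, sq]
    simp only [h3]
    exact (hasSum_sum fun a _ => hF2 a).unique (hasSum_respMom θ h hθ)

end Moments

end PredictionError

end LPVMA

namespace LPVMA

/-! ### The asymptotic loss -/

section Stationarity

variable {ι : Type*} [Fintype ι] [DecidableEq ι] {V : (ι → ℝ) → ℝ} {θ : ι → ℝ}

theorem hasDerivAt_comp_update (hV : DifferentiableAt ℝ V θ) (x : ι) :
    HasDerivAt (fun s : ℝ => V (Function.update θ x s)) (fderiv ℝ V θ (Pi.single x 1)) (θ x) := by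
  have h1 : HasDerivAt (Function.update θ x) (Pi.single x (1 : ℝ)) (θ x) :=
    hasDerivAt_update θ x (θ x)
  have h2 : HasFDerivAt V (fderiv ℝ V θ) (Function.update θ x (θ x)) := by
    rw [Function.update_eq_self]
    exact hV.hasFDerivAt
  exact h2.comp_hasDerivAt _ h1

theorem isStationary_iff_fderiv_eq_zero (hV : DifferentiableAt ℝ V θ) :
    IsStationary V θ ↔ fderiv ℝ V θ = 0 := by
  constructor
  · intro h
    have h1 : (fderiv ℝ V θ : (ι → ℝ) →ₗ[ℝ] ℝ) = 0 :=
      LinearMap.pi_ext' fun x => LinearMap.ext_ring ((hasDerivAt_comp_update hV x).unique (h x))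
    exact ContinuousLinearMap.coe_injective h1
  · intro h x
    have := hasDerivAt_comp_update hV x
    rwa [h] at this

end Stationarity

/-! ### Transfer of the second-moment results to the loss -/

section Loss

variable {Ω : Type*} [MeasurableSpace Ω] {μ : Measure Ω} [IsProbabilityMeasure μ] {np ny n m M : ℕ}
  {p : Fin np → ℤ → Ω → ℝ} {e : ℤ → Ω → Fin ny → ℝ} {S : Matrix (Fin ny) (Fin ny) ℝ}

variable (hp : IsSchedulingNoise μ p e M) (hM : 4 ≤ M) (he : IsGaussianNoise μ e S)

include hp hM he

theorem tendsto_avgLoss (hm : n ≤ m) {θ : Param np ny m} (hθ : StableMat (trans μ (sched₀ p) θ))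
    (h : Param np ny n) :
    Tendsto (avgLoss μ h p e θ) atTop (𝓝 (momLoss μ (sched₀ p) S (extend m h) θ)) := by
  refine tendsto_const_nhds.congr' ?_
  -- The second moment of `ε(θ, t)` does not depend on `t`, so the average is constant for `N ≠ 0`;
  -- at `N = 0` it is zero.
  filter_upwards [eventually_ne_atTop 0] with N hN
  have h1 : ∀ t : ℤ, Matrix.trace (Matrix.of fun a b : Fin ny =>
      ∫ ω, predError h p e θ t ω a * predError h p e θ t ω b ∂μ)
      = momLoss μ (sched₀ p) S (extend m h) θ := fun t => by
    rw [← predError_extend hm]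
    exact (predError_spec hp hM he hθ (extend m h) t).2.2
  simp only [avgLoss, h1, Finset.sum_const, Nat.card_Icc, Nat.add_sub_cancel, nsmul_eq_mul]
  rw [← mul_assoc, one_div_mul_cancel (Nat.cast_ne_zero.mpr hN), one_mul]

theorem loss_eq_momLoss (hm : n ≤ m) {θ : Param np ny m}
    (hθ : StableMat (trans μ (sched₀ p) θ)) (h : Param np ny n) :
    loss μ h p e θ = momLoss μ (sched₀ p) S (extend m h) θ :=
  (tendsto_avgLoss hp hM he hm hθ h).limUnder_eq

theorem loss_eventuallyEq_momLoss (hm : n ≤ m) {θ : Param np ny m}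
    (hθ : StableMat (trans μ (sched₀ p) θ)) (h : Param np ny n) :
    loss μ h p e =ᶠ[𝓝 θ] momLoss μ (sched₀ p) S (extend m h) := by
  filter_upwards [(isOpen_stableMat_trans (hp.isWhite hM)).mem_nhds hθ] with θ' hθ'
  exact loss_eq_momLoss hp hM he hm hθ' h

theorem differentiableAt_loss (hm : n ≤ m) {θ : Param np ny m}
    (hθ : StableMat (trans μ (sched₀ p) θ)) (h : Param np ny n) :
    DifferentiableAt ℝ (loss μ h p e) θ :=
  (differentiableAt_momLoss (hp.isWhite hM) S (extend m h) hθ).congr_of_eventuallyEq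
    (loss_eventuallyEq_momLoss hp hM he hm hθ h)

theorem eq_extend_of_fderiv_loss_eq_zero (hS : S.PosDef) (hm : n ≤ m) {θ : Param np ny m}
    (hθ : StableMat (trans μ (sched₀ p) θ)) {h : Param np ny n}
    (hh : StableMat (trans μ (sched₀ p) (extend m h)))
    (hV : fderiv ℝ (loss μ h p e) θ = 0) : θ = extend m h := by
  refine eq_of_stationary (hp.isWhite hM) hS hθ hh fun v => ?_
  have h1 : HasFDerivAt (momLoss μ (sched₀ p) S (extend m h)) (0 : Param np ny m →L[ℝ] ℝ)
      (θ + (0 : ℝ) • v) := by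
    rw [zero_smul, add_zero, ← hV]
    exact (differentiableAt_loss hp hM he hm hθ h).hasFDerivAt.congr_of_eventuallyEq
      (loss_eventuallyEq_momLoss hp hM he hm hθ h).symm
  have h2 : HasDerivAt (fun s : ℝ => θ + s • v) v 0 := by
    simpa using ((hasDerivAt_id (0 : ℝ)).smul_const v).const_add θ
  exact h1.comp_hasDerivAt 0 h2

/-- The value `S.trace` is a lower bound on the open stable set, so attaining it gives a local
minimum. -/
theorem fderiv_loss_eq_zero (hS : S.PosSemidef) (hm : n ≤ m) {θ : Param np ny m}
    (hθ : StableMat (trans μ (sched₀ p) θ)) {h : Param np ny n}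
    (hmin : loss μ h p e θ = S.trace) : fderiv ℝ (loss μ h p e) θ = 0 := by
  refine IsLocalMin.fderiv_eq_zero ?_
  filter_upwards [(isOpen_stableMat_trans (hp.isWhite hM)).mem_nhds hθ] with θ' hθ'
  rw [hmin, loss_eq_momLoss hp hM he hm hθ' h]
  exact trace_le_momLoss (hp.isWhite hM) hS _ hθ'

end Loss

end LPVMA

theorem mainTheorem2 {Ω : Type*} [MeasurableSpace Ω] (μ : Measure Ω) [IsProbabilityMeasure μ]
    (np ny nc nc' : ℕ) (hnc : nc ≤ nc')
    (p : Fin np → ℤ → Ω → ℝ) (e : ℤ → Ω → Fin ny → ℝ)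
    (S : Matrix (Fin ny) (Fin ny) ℝ) (hS : S.PosDef)
    (he : IsGaussianNoise μ e S)
    (hp : IsSchedulingNoise μ p e (6 + nc'))
    (h : Param np ny nc) (hh : h ∈ stableSet ny nc μ p) :
    -- the loss is well defined and differentiable on the parameter set
    (IsOpen (stableSet ny nc' μ p) ∧
      ∀ θ ∈ stableSet ny nc' μ p,
        (∀ t : ℤ, (∀ᵐ ω ∂μ, Summable fun i : ℕ =>
            (invCoeff θ (traj p ω) t i).mulVec (output h p e (t - (i : ℤ)) ω)) ∧
          MemLp (predError h p e θ t) 2 μ) ∧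
        Tendsto (avgLoss μ h p e θ) atTop (𝓝 (loss μ h p e θ)) ∧
        DifferentiableAt ℝ (loss μ h p e) θ) ∧
    -- the global minimum is the trace of the noise covariance
    IsLeast (loss μ h p e '' stableSet ny nc' μ p) S.trace ∧
    (∀ θ ∈ stableSet ny nc' μ p, loss μ h p e θ = S.trace ↔ θ = extend nc' h) ∧
    -- the unique stationary point is the true parameter vector
    extend nc' h ∈ stableSet ny nc' μ p ∧
    (∀ θ ∈ stableSet ny nc' μ p, IsStationary (loss μ h p e) θ ↔ θ = extend nc' h) := by
  have hM : 4 ≤ 6 + nc' := by omega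
  have hstab : ∀ θ : Param np ny nc', θ ∈ stableSet ny nc' μ p ↔ StableMat (trans μ (sched₀ p) θ) :=
    mem_stableSet_iff hp hM
  have hopen : IsOpen (stableSet ny nc' μ p) := by
    have : stableSet ny nc' μ p = {θ | StableMat (trans μ (sched₀ p) θ)} := Set.ext hstab
    rw [this]
    exact isOpen_stableMat_trans (hp.isWhite hM)
  have hext : extend nc' h ∈ stableSet ny nc' μ p := by
    intro t
    simpa only [invCoeff_extend hnc] using hh t
  have hext' := (hstab _).mp hext
  have hmin : loss μ h p e (extend nc' h) = S.trace := by
    rw [loss_eq_momLoss hp hM he hnc hext', momLoss_self]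
  have hunique : ∀ θ ∈ stableSet ny nc' μ p, fderiv ℝ (loss μ h p e) θ = 0 → θ = extend nc' h :=
    fun θ hθ => eq_extend_of_fderiv_loss_eq_zero hp hM he hS hnc ((hstab θ).mp hθ) hext'
  -- Minimizers are stationary, so `hunique` covers uniqueness of the minimizer too.
  have hzero : ∀ θ ∈ stableSet ny nc' μ p, loss μ h p e θ = S.trace →
      fderiv ℝ (loss μ h p e) θ = 0 :=
    fun θ hθ => fderiv_loss_eq_zero hp hM he hS.posSemidef hnc ((hstab θ).mp hθ)
  have hdiff : ∀ θ ∈ stableSet ny nc' μ p, DifferentiableAt ℝ (loss μ h p e) θ :=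
    fun θ hθ => differentiableAt_loss hp hM he hnc ((hstab θ).mp hθ) h
  refine ⟨⟨hopen, fun θ hθ => ⟨fun t => ?_, ?_, hdiff θ hθ⟩⟩, ⟨⟨_, hext, hmin⟩, ?_⟩,
    fun θ hθ => ⟨fun hV => hunique θ hθ (hzero θ hθ hV), fun hθh => hθh ▸ hmin⟩, hext,
    fun θ hθ => ?_⟩
  · have h1 := predError_spec hp hM he ((hstab θ).mp hθ) (extend nc' h) t
    rw [predError_extend hnc, output_extend hnc] at h1
    exact ⟨h1.1, h1.2.1⟩
  · rw [loss_eq_momLoss hp hM he hnc ((hstab θ).mp hθ)]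
    exact tendsto_avgLoss hp hM he hnc ((hstab θ).mp hθ) h
  · rintro _ ⟨θ, hθ, rfl⟩
    rw [loss_eq_momLoss hp hM he hnc ((hstab θ).mp hθ)]
    exact trace_le_momLoss (hp.isWhite hM) hS.posSemidef _ ((hstab θ).mp hθ)
  · rw [isStationary_iff_fderiv_eq_zero (hdiff θ hθ)]
    exact ⟨hunique θ hθ, fun hθh => by rw [hθh]; exact hzero _ hext hmin⟩
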